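/- Let $G=(V,E)$ be a locally finite, connected, (vertex-)transitive and transient simple graph, and let $\Gamma=\mathrm{Aut}(G)$ be its automorphism group. Here $G$ is transient if the simple random walk on $G$, from any starting vertex, almost surely visits every vertex only finitely many times. $G$ is called unimodular if $$\sum_{x\in V} f(o,x)=\sum_{x\in V} f(x,o)\in[0,\infty]$$ for every $o\in V$ and every $f:V\times V\to[0,\infty)$ satisfying $f(\varphi(x),\varphi(y))=f(x,y)$ for all $x,y\in V$, $\varphi\in\Gamma$. Let $W$ be the set of all $w:\mathbb Z\to V$ such that $\{w(n),w(n+1)\}\in E$ for all $n\in\mathbb Z$ and $\{n\in\mathbb Z: w(n)=x\}$ is finite for every $x\in V$, and let $\mathcal W$ be the $\sigma$-algebra on $W$ generated by the coordinate maps. The group $\Gamma$ acts on $W$ by $\varphi(w)=(\varphi(w(n)))_{n\in\mathbb Z}$. Let $W^*$ be the quotient of $W$ by the time shifts, i.e. $w\sim w'$ if there is $k\in\mathbb Z$ with $w(n)=w'(n+k)$ for all $n\in\mathbb Z$. Let $\pi^*:W\to W^*$ be the projection and $\mathcal W^*=\{A\subseteq W^*:(\pi^*)^{-1}(A)\in\mathcal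 W\}$. For $x\in V$ let $P_x^{\pm}$ be the law on $W$ of the doubly infinite simple random walk $(X(n))_{n\in\mathbb Z}$ with $X(0)=x$, i.e. $(X(n))_{n\ge 0}$ and $(X(-n))_{n\ge 0}$ are independent simple random walks on $G$ started from $x$. The interlacement measure $\nu$ is the unique $\sigma$-finite measure on $(W^*,\mathcal W^*)$ such that for every $A\in\mathcal W^*$ and every finite $K\subset V$ $$\nu\big(A\cap W^*(K)\big)=\sum_{x\in K}P_x^{\pm}\big((\pi^*)^{-1}(A)\cap\{H_K=0\}\big),$$ where $W^*(K)$ is the set of classes of trajectories that visit $K$, and $H_K(w)=\min\{n\in\mathbb Z: w(n)\in K\}$ for $w\in W$ that visits $K$. Then the following two conditions are equivalent: (A) $G$ is unimodular. (B) There is no measure $Q$ on $(W,\mathcal W)$ such that (i) $\nu(A)=Q((\pi^*)^{-1}(A))$ for all $A\in\mathcal W^*$, and (ii) $Q(B)=Q(\varphi(B))$ for all $B\in\mathcal W$ and all $\varphi\in\Gamma$. -/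

import Mathlib

open MeasureTheory ProbabilityTheory
open scoped ENNReal NNReal

noncomputable section

namespace RI

variable {V : Type*}

/-! Throughout, `G` is a simple graph on `V`, and `V` carries the discrete σ-algebra. -/

/-- Vertex-transitivity: the automorphism group acts transitively on the vertices. -/
def IsTransitive (G : SimpleGraph V) : Prop :=
  ∀ x y : V, ∃ φ : G ≃g G, φ x = y

/-- Mass transport functions: nonnegative functions on `V × V` which are invariant under the
diagonal action of the automorphism group. -/
def IsMassTransport (G : SimpleGraph V) (f : V → V → ℝ≥0) : Prop :=
  ∀ (φ : G ≃g G) (x y : V), f (φ x) (φ y) = f x y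

/-- Unimodularity: the mass transport principle. Both sums take values in `[0, ∞]`. -/
def IsUnimodular (G : SimpleGraph V) : Prop :=
  ∀ f : V → V → ℝ≥0, IsMassTransport G f →
    ∀ o : V, ∑' x, (f o x : ℝ≥0∞) = ∑' x, (f x o : ℝ≥0∞)

section Walk

variable (G : SimpleGraph V) [G.LocallyFinite]

/-- One step of the simple random walk from `x`: the uniform distribution on the neighbours of
`x`. (A walk at an isolated vertex, which has nowhere to go, stays there.) -/
def srwStep (x : V) : PMF V :=
  if h : (G.neighborFinset x).Nonempty then PMF.uniformOfFinset (G.neighborFinset x) h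
  else PMF.pure x

variable [MeasurableSpace V] [DiscreteMeasurableSpace V]

/-- The transition kernel of the simple random walk. -/
def srwKernel : Kernel V V where
  toFun x := (srwStep G x).toMeasure
  measurable' := Measurable.of_discrete

instance : IsMarkovKernel (srwKernel G) :=
  ⟨fun x => inferInstanceAs (IsProbabilityMeasure (srwStep G x).toMeasure)⟩

/-- The conditional law of the position at time `n + 1` given the positions up to time `n`. -/
def srwHistoryKernel (n : ℕ) : Kernel (Finset.Iic n → V) V :=
  (srwKernel G).comap (fun h => h ⟨n, Finset.mem_Iic.2 le_rfl⟩) (measurable_pi_apply _)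

instance (n : ℕ) : IsMarkovKernel (srwHistoryKernel G n) :=
  inferInstanceAs (IsMarkovKernel ((srwKernel G).comap _ _))

/-- The law of the simple random walk `(X(n))_{n ∈ ℕ}` with `X(0) = x`
(Ionescu-Tulcea construction). -/
def srwLaw (x : V) : Measure (ℕ → V) :=
  Kernel.traj (X := fun _ => V) (srwHistoryKernel G) 0 (fun _ => x)

/-- `G` is transient: from every starting point the simple random walk almost surely visits every
vertex only finitely many times. -/
def IsTransient : Prop :=
  ∀ x : V, ∀ᵐ w ∂(srwLaw G x), ∀ y : V, {n : ℕ | w n = y}.Finite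

end Walk

/-- The space `W` of doubly infinite nearest neighbour trajectories which visit every vertex only
finitely many times. -/
def Trajectory (G : SimpleGraph V) : Type _ :=
  {w : ℤ → V // (∀ n, G.Adj (w n) (w (n + 1))) ∧ ∀ x, {n : ℤ | w n = x}.Finite}

instance (G : SimpleGraph V) : CoeFun (Trajectory G) (fun _ => ℤ → V) := ⟨fun w => w.1⟩

/-- The σ-algebra on `W` generated by the coordinate maps. -/
instance (G : SimpleGraph V) [MeasurableSpace V] : MeasurableSpace (Trajectory G) :=
  inferInstanceAs (MeasurableSpace
    {w : ℤ → V // (∀ n, G.Adj (w n) (w (n + 1))) ∧ ∀ x, {n : ℤ | w n = x}.Finite})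

/-- The action of an automorphism on a trajectory, `φ(w) = (φ(w(n)))_{n ∈ ℤ}`. -/
def Trajectory.act {G : SimpleGraph V} (φ : G ≃g G) (w : Trajectory G) : Trajectory G :=
  ⟨fun n => φ (w n), fun n => φ.map_adj_iff.2 (w.2.1 n), fun x =>
    (w.2.2 (φ.symm x)).subset fun n (hn : φ (w n) = x) => by
      change w n = φ.symm x
      rw [← hn, RelIso.symm_apply_apply]⟩

/-- Equivalence of trajectories modulo time shift. -/
def timeShift (G : SimpleGraph V) : Setoid (Trajectory G) where
  r v w := ∃ k : ℤ, ∀ n : ℤ, v n = w (n + k)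
  iseqv :=
    { refl := fun w => ⟨0, fun n => by rw [add_zero]⟩
      symm := by
        rintro v w ⟨k, h⟩
        exact ⟨-k, fun n => by rw [h, neg_add_cancel_right]⟩
      trans := by
        rintro u v w ⟨k, h⟩ ⟨l, h2⟩
        exact ⟨k + l, fun n => by rw [h, h2, add_assoc]⟩ }

/-- The space `W*` of trajectories modulo time shift. -/
def ShiftClass (G : SimpleGraph V) : Type _ := Quotient (timeShift G)

/-- The projection `π* : W → W*`. -/
def proj (G : SimpleGraph V) : Trajectory G → ShiftClass G := Quotient.mk (timeShift G)

/-- The σ-algebra on `W*`: a set is measurable iff its preimage under `π*` is. -/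
instance (G : SimpleGraph V) [MeasurableSpace V] : MeasurableSpace (ShiftClass G) :=
  MeasurableSpace.map (proj G) inferInstance

/-- `W*(K)`: the classes of the trajectories that visit `K`. -/
def hitting (G : SimpleGraph V) (K : Finset V) : Set (ShiftClass G) :=
  proj G '' {w | ∃ n : ℤ, w n ∈ K}

/-- The event `H_K = 0`: the first entrance time into `K` exists and equals `0`. -/
def firstEntranceZero (G : SimpleGraph V) (K : Finset V) : Set (Trajectory G) :=
  {w | IsLeast {n : ℤ | w n ∈ K} 0}

/-- Glue a forward path and a backward path to a path indexed by `ℤ`. -/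
def glue (p : (ℕ → V) × (ℕ → V)) (n : ℤ) : V :=
  if 0 ≤ n then p.1 n.toNat else p.2 (-n).toNat

section Interlacement

variable [MeasurableSpace V]

lemma measurable_glue : Measurable (glue : (ℕ → V) × (ℕ → V) → ℤ → V) := by
  refine measurable_pi_iff.2 fun n => ?_
  by_cases h : 0 ≤ n
  · simp only [glue, h, if_true]; fun_prop
  · simp only [glue, h, if_false]; fun_prop

variable (G : SimpleGraph V) [G.LocallyFinite] [DiscreteMeasurableSpace V]

/-- The law `P^±_x` on `W` of the doubly infinite simple random walk `(X(n))_{n ∈ ℤ}` with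
`X(0) = x`: the forward path `(X(n))_{n ≥ 0}` and the backward path `(X(-n))_{n ≥ 0}` are
independent simple random walks from `x`. The law on `ℤ → V` is concentrated on `W` if the graph is
transient, and it is viewed as a measure on `W`. -/
def twoSidedLaw (x : V) : Measure (Trajectory G) :=
  Measure.comap (fun w : Trajectory G => (w : ℤ → V))
    (((srwLaw G x).prod (srwLaw G x)).map glue)

/-- `Q_K(B) = ∑_{x ∈ K} P^±_x(B, H_K = 0)`. -/
def entranceMass (K : Finset V) (B : Set (Trajectory G)) : ℝ≥0∞ :=
  ∑ x ∈ K, twoSidedLaw G x (B ∩ firstEntranceZero G K)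

/-- The property that characterizes the interlacement intensity measure among the σ-finite
measures on `W*`: `ν(A ∩ W*(K)) = Q_K((π*)⁻¹(A))` for all measurable `A` and finite `K`. -/
structure IsInterlacementMeasure (ν : Measure (ShiftClass G)) : Prop where
  sigmaFinite : SigmaFinite ν
  apply_inter_hitting : ∀ A : Set (ShiftClass G), MeasurableSet A → ∀ K : Finset V,
    ν (A ∩ hitting G K) = entranceMass G K (proj G ⁻¹' A)

/-- The interlacement measure `ν` on `W*`: the σ-finite measure with
`ν(A ∩ W*(K)) = Q_K((π*)⁻¹(A))` for all measurable `A` and finite `K`. (On a transient graph which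
is locally finite, connected and transitive there is exactly one such measure.) -/
def interlacementMeasure : Measure (ShiftClass G) :=
  Classical.epsilon (IsInterlacementMeasure G)

/-- `Q` projects to the interlacement measure: `ν(A) = Q((π*)⁻¹(A))` for measurable `A ⊆ W*`. -/
def ProjectsToInterlacement (Q : Measure (Trajectory G)) : Prop :=
  ∀ A : Set (ShiftClass G), MeasurableSet A → interlacementMeasure G A = Q (proj G ⁻¹' A)

end Interlacement

/-- `Q` is invariant under automorphisms: `Q(B) = Q(φ(B))` for measurable `B ⊆ W`. -/
def IsAutInvariant (G : SimpleGraph V) [MeasurableSpace V] (Q : Measure (Trajectory G)) : Prop :=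
  ∀ (φ : G ≃g G) (B : Set (Trajectory G)), MeasurableSet B → Q B = Q (Trajectory.act φ '' B)

end RI

end

open MeasureTheory ProbabilityTheory
open scoped ENNReal NNReal

noncomputable section

namespace RI


/-! Let `Δ(x, y) = |Γ_y x| / |Γ_x y|` be the modular function and let `μ = ∑ₓ P_x^±` be the law of
the doubly infinite walk summed over all starting points (`totalLaw`). A transitive graph is
regular, so the walk is reversible with respect to counting measure. Hence `μ` is invariant under
time shifts, and it is invariant under automorphisms as well. Call a set of trajectories a section
if almost every trajectory enters it under exactly one shift. By shift invariance all sections give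
the same mass to each shift-invariant set (`measure_inter_eq_of_selection`). Since `{H_K = 0}` is a
section over the trajectories that hit `K`, restricting `μ` to any section and projecting gives `ν`.
An invariant lift of `ν` is therefore available as soon as there is an automorphism-invariant
section.

If `G` is not unimodular, then `Δ` is a nontrivial cocycle, and the mass transport principle tilted
by `Δ` shows that `Δ(x, ·)` averages to `1` over the neighbours of `x`. By strict AM-GM, `h = √Δ(o,
·)` is an eigenfunction of the walk with eigenvalue `c < 1`. So `∑ₙ h(X(n))` has finite expectation
and `h` tends to `0` along both ends of the walk. Automorphisms only rescale `h`, so starting the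
clock at the first maximum of `h` is an invariant section
(`exists_invariant_lift_of_not_isUnimodular`).

If `Q` is an invariant lift, let `x` send to `y` the mass `Q(w(0) = x, w visits y)`. The mass
received by `y` is `ν(W*({y})) ≤ 1`, but a vertex `x` with `Q(w(0) = x) > 0` sends out infinite
mass, because each trajectory visits infinitely many vertices. This contradicts mass transport
(`not_isUnimodular_of_invariant_lift`). -/

/-! ### The modular function of a group action and the tilted mass transport principle -/

section Modular

open MulAction

variable {Γ X : Type*} [Group Γ] [MulAction Γ X]

/-- The modular function `|Γ_y x| / |Γ_x y|` of a group action with finite stabilizer orbits. -/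
def modularRatio (Γ : Type*) {X : Type*} [Group Γ] [MulAction Γ X] (x y : X) : ℝ≥0 :=
  ((stabilizer Γ x).relIndex (stabilizer Γ y) : ℝ≥0) / (stabilizer Γ y).relIndex (stabilizer Γ x)

lemma ncard_orbit_stabilizer (x y : X) :
    (orbit (stabilizer Γ x) y).ncard = (stabilizer Γ y).relIndex (stabilizer Γ x) := by
  rw [← index_stabilizer]
  rfl

lemma relIndex_stabilizer_smul (g : Γ) (x y : X) :
    (stabilizer Γ (g • x)).relIndex (stabilizer Γ (g • y)) =
      (stabilizer Γ x).relIndex (stabilizer Γ y) := by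
  rw [stabilizer_smul_eq_stabilizer_map_conj, stabilizer_smul_eq_stabilizer_map_conj]
  exact Subgroup.relIndex_map_map_of_injective _ _ (MulAut.conj g).injective

lemma modularRatio_smul (g : Γ) (x y : X) :
    modularRatio Γ (g • x) (g • y) = modularRatio Γ x y := by
  simp only [modularRatio, relIndex_stabilizer_smul]

lemma modularRatio_ne_zero
    (hfin : ∀ x y : X, (stabilizer Γ x).relIndex (stabilizer Γ y) ≠ 0) (x y : X) :
    modularRatio Γ x y ≠ 0 :=
  div_ne_zero (by exact_mod_cast hfin x y) (by exact_mod_cast hfin y x)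

/-- The cocycle identity. Each index of `H ⊓ K ⊓ L` in `H`, `K` or `L` factors through two different
pairwise intersections; multiplied cyclically, these factorizations leave only the indices that
occur in `modularRatio`. -/
lemma modularRatio_mul
    (hfin : ∀ x y : X, (stabilizer Γ x).relIndex (stabilizer Γ y) ≠ 0) (x y z : X) :
    modularRatio Γ x y * modularRatio Γ y z = modularRatio Γ x z := by
  have key : ∀ H K L : Subgroup Γ, L.relIndex (H ⊓ K) * K.relIndex H = (H ⊓ K ⊓ L).relIndex H := by
    intro H K L
    have h := Subgroup.relIndex_inf_mul_relIndex L K H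
    rw [inf_comm K H] at h
    rw [h, inf_assoc, Subgroup.inf_relIndex_left, inf_comm]
  set H := stabilizer Γ x
  set K := stabilizer Γ y
  set L := stabilizer Γ z
  have hxy : L.relIndex (H ⊓ K) ≠ 0 := fun h =>
    hfin z x (Subgroup.relIndex_eq_zero_of_le_right inf_le_left h)
  have hyz : H.relIndex (K ⊓ L) ≠ 0 := fun h =>
    hfin x y (Subgroup.relIndex_eq_zero_of_le_right inf_le_left h)
  have hxz : K.relIndex (H ⊓ L) ≠ 0 := fun h =>
    hfin y x (Subgroup.relIndex_eq_zero_of_le_right inf_le_left h)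
  have e1 := key H K L
  have e2 := key K H L
  have e3 := key K L H
  have e4 := key L K H
  have e5 := key H L K
  have e6 := key L H K
  rw [inf_comm K H] at e2
  rw [inf_comm L K] at e4
  rw [inf_comm L H] at e6
  rw [show K ⊓ L ⊓ H = H ⊓ K ⊓ L by rw [inf_comm, inf_assoc]] at e3 e4
  rw [show H ⊓ L ⊓ K = H ⊓ K ⊓ L by rw [inf_assoc, inf_comm L, inf_assoc]] at e5 e6
  have f1 : (H.relIndex K : ℝ≥0) ≠ 0 := by exact_mod_cast hfin x y
  have f2 : (K.relIndex H : ℝ≥0) ≠ 0 := by exact_mod_cast hfin y x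
  have f3 : (K.relIndex L : ℝ≥0) ≠ 0 := by exact_mod_cast hfin y z
  have f4 : (L.relIndex K : ℝ≥0) ≠ 0 := by exact_mod_cast hfin z y
  have f5 : (H.relIndex L : ℝ≥0) ≠ 0 := by exact_mod_cast hfin x z
  have f6 : (L.relIndex H : ℝ≥0) ≠ 0 := by exact_mod_cast hfin z x
  have main : H.relIndex K * K.relIndex L * L.relIndex H =
      K.relIndex H * L.relIndex K * H.relIndex L := by
    -- The indices of the triple intersection in the pairwise ones occur on both sides and can be
    -- cancelled because they are nonzero.
    have hpos : 0 < L.relIndex (H ⊓ K) * H.relIndex (K ⊓ L) * K.relIndex (H ⊓ L) := by positivity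
    refine Nat.eq_of_mul_eq_mul_left hpos ?_
    calc _ = (L.relIndex (H ⊓ K) * H.relIndex K) * (H.relIndex (K ⊓ L) * K.relIndex L) *
          (K.relIndex (H ⊓ L) * L.relIndex H) := by ring
      _ = (L.relIndex (H ⊓ K) * K.relIndex H) * (H.relIndex (K ⊓ L) * L.relIndex K) *
          (K.relIndex (H ⊓ L) * H.relIndex L) := by rw [e1, e2, e3, e4, e5, e6]; ring
      _ = _ := by ring
  have main' : (H.relIndex K * K.relIndex L * L.relIndex H : ℝ≥0) =
      K.relIndex H * L.relIndex K * H.relIndex L := by exact_mod_cast main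
  change (H.relIndex K / K.relIndex H * (K.relIndex L / L.relIndex K) : ℝ≥0) =
    H.relIndex L / L.relIndex H
  field_simp
  linear_combination main'

lemma modularRatio_self
    (hfin : ∀ x y : X, (stabilizer Γ x).relIndex (stabilizer Γ y) ≠ 0) (x : X) :
    modularRatio Γ x x = 1 :=
  div_self (by exact_mod_cast hfin x x)

/-- The mass transport principle, tilted by the modular function. -/
lemma tsum_mass_transport [IsPretransitive Γ X]
    (hfin : ∀ x y : X, (stabilizer Γ x).relIndex (stabilizer Γ y) ≠ 0)
    (f : X → X → ℝ≥0∞) (hf : ∀ (g : Γ) (x y : X), f (g • x) (g • y) = f x y) (o : X) :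
    ∑' y, f y o = ∑' y, f o y * modularRatio Γ o y := by
  -- Both sums are split along the orbits of `Γ` on pairs. On the orbit of `(o, y)` each summand is
  -- constant, so only the fibre sizes matter: `|Γ_y o|` on the left and `|Γ_o y|` on the right,
  -- with quotient `Δ(o, y)`.
  rw [← ENNReal.tsum_fiberwise (fun y => f y o) (fun y => orbit Γ (y, o)),
    ← ENNReal.tsum_fiberwise (fun y => f o y * modularRatio Γ o y) (fun y => orbit Γ (o, y))]
  refine tsum_congr fun ω => ?_
  by_cases hω : ∃ y, orbit Γ (o, y) = ω
  · obtain ⟨y, rfl⟩ := hω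
    obtain ⟨g, hg⟩ := exists_smul_eq Γ y o
    have hS : (fun z => orbit Γ (z, o)) ⁻¹' {orbit Γ (o, y)} = orbit (stabilizer Γ o) (g • o) := by
      ext z
      simp only [Set.mem_preimage, Set.mem_singleton_iff, orbit_eq_iff]
      constructor
      · rintro ⟨k, hk⟩
        obtain ⟨h1, h2⟩ := Prod.ext_iff.1 hk
        replace h1 : k • o = z := h1
        replace h2 : k • y = o := h2
        refine ⟨⟨k * g⁻¹, ?_⟩, ?_⟩
        · rw [mem_stabilizer_iff, mul_smul, ← hg, inv_smul_smul, h2, hg]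
        · change (k * g⁻¹) • g • o = z
          rw [mul_smul, inv_smul_smul, h1]
      · rintro ⟨⟨k, hk⟩, rfl⟩
        exact ⟨k * g, Prod.ext (mul_smul _ _ _) ((mul_smul _ _ _).trans (by rw [hg]; exact hk))⟩
    have hT : (fun z => orbit Γ (o, z)) ⁻¹' {orbit Γ (o, y)} = orbit (stabilizer Γ o) y := by
      ext z
      simp only [Set.mem_preimage, Set.mem_singleton_iff, orbit_eq_iff]
      constructor
      · rintro ⟨k, hk⟩
        obtain ⟨h1, h2⟩ := Prod.ext_iff.1 hk
        exact ⟨⟨k, h1⟩, h2⟩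
      · rintro ⟨⟨k, hk⟩, rfl⟩
        exact ⟨k, Prod.ext hk rfl⟩
    rw [hS, hT]
    have e1 : ∀ z : orbit (stabilizer Γ o) (g • o), f z o = f o y := by
      rintro ⟨_, ⟨⟨k, hk⟩, rfl⟩⟩
      change f (k • g • o) o = _
      rw [← hf g o y, ← hf k (g • o) (g • y), hg, mem_stabilizer_iff.1 hk]
    have e2 : ∀ z : orbit (stabilizer Γ o) y,
        f o z * modularRatio Γ o (z : X) = f o y * modularRatio Γ o y := by
      rintro ⟨_, ⟨⟨k, hk⟩, rfl⟩⟩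
      change f o (k • y) * modularRatio Γ o (k • y) = _
      rw [← hf k o y, ← modularRatio_smul k o y, mem_stabilizer_iff.1 hk]
    have hn1 : ∀ x y : X, (orbit (stabilizer Γ x) y).Finite := fun x y =>
      Set.finite_of_ncard_ne_zero (by rw [ncard_orbit_stabilizer]; exact hfin y x)
    rw [tsum_congr e1, tsum_congr e2, ENNReal.tsum_set_const, ENNReal.tsum_set_const,
      ← (hn1 _ _).cast_ncard_eq, ← (hn1 _ _).cast_ncard_eq, ncard_orbit_stabilizer,
      ncard_orbit_stabilizer]
    have hc : (stabilizer Γ (g • o)).relIndex (stabilizer Γ o) =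
        (stabilizer Γ o).relIndex (stabilizer Γ y) := by
      have h := relIndex_stabilizer_smul g o y
      rwa [hg] at h
    have hy : ((stabilizer Γ y).relIndex (stabilizer Γ o) : ℝ≥0) ≠ 0 := by
      exact_mod_cast hfin y o
    have hr : ((stabilizer Γ y).relIndex (stabilizer Γ o) : ℝ≥0) * modularRatio Γ o y =
        (stabilizer Γ o).relIndex (stabilizer Γ y) := by
      rw [modularRatio]
      field_simp
    have hr' : ((stabilizer Γ y).relIndex (stabilizer Γ o) : ℝ≥0∞) * modularRatio Γ o y =
        (stabilizer Γ o).relIndex (stabilizer Γ y) := by exact_mod_cast hr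
    rw [hc, ENat.toENNReal_coe, ENat.toENNReal_coe, ← hr']
    ring
  -- By transitivity an orbit that meets `X × {o}` also meets `{o} × X`, so both fibres are empty
  -- here.
  · have h1 : (fun z => orbit Γ (z, o)) ⁻¹' {ω} = ∅ := by
      refine Set.eq_empty_of_forall_notMem fun z hz => hω ?_
      obtain ⟨g, hg⟩ := exists_smul_eq Γ z o
      refine ⟨g • o, ?_⟩
      rw [← Set.mem_singleton_iff.1 hz, orbit_eq_iff]
      exact ⟨g, Prod.ext hg rfl⟩
    have h2 : (fun z => orbit Γ (o, z)) ⁻¹' {ω} = ∅ :=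
      Set.eq_empty_of_forall_notMem fun z hz => hω ⟨z, hz⟩
    rw [h1, h2]
    simp

end Modular


/-! ### Locally finite transitive graphs -/

section Graph

open MulAction

variable {V : Type*} {G : SimpleGraph V}

lemma finite_setOf_walk_length [G.LocallyFinite] (n : ℕ) (x : V) :
    {y | ∃ p : G.Walk x y, p.length = n}.Finite := by
  induction n generalizing x with
  | zero =>
    refine (Set.finite_singleton x).subset ?_
    rintro y ⟨p, hp⟩
    exact (SimpleGraph.Walk.eq_of_length_eq_zero hp).symm
  | succ n ih =>
    refine ((G.neighborFinset x).finite_toSet.biUnion fun z _ => ih z).subset ?_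
    rintro y ⟨p, hp⟩
    cases p with
    | nil => simp at hp
    | @cons _ z _ h q =>
      simp only [SimpleGraph.Walk.length_cons, add_left_inj] at hp
      simp only [Set.mem_iUnion]
      exact ⟨z, by simpa using h, q, hp⟩

lemma countable_of_connected [G.LocallyFinite] (hconn : G.Connected) : Countable V := by
  obtain ⟨x⟩ := hconn.nonempty
  have : (Set.univ : Set V) = ⋃ n, {y | ∃ p : G.Walk x y, p.length = n} := by
    ext y
    obtain ⟨p⟩ := hconn.preconnected x y
    simp only [Set.mem_univ, Set.mem_iUnion, true_iff]
    exact ⟨p.length, p, rfl⟩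
  rw [← Set.countable_univ_iff, this]
  exact Set.countable_iUnion fun n => (finite_setOf_walk_length n x).countable

/-- An automorphism fixing `y` preserves the length of walks from `y`, so it moves `x` within a
finite set. This makes `Δ` finite and positive. -/
lemma relIndex_stabilizer_ne_zero [G.LocallyFinite] (hconn : G.Connected) (x y : V) :
    (stabilizer (G ≃g G) x).relIndex (stabilizer (G ≃g G) y) ≠ 0 := by
  rw [← ncard_orbit_stabilizer]
  obtain ⟨p⟩ := hconn.preconnected y x
  have hfin : (orbit (stabilizer (G ≃g G) y) x).Finite := by
    refine (finite_setOf_walk_length (G := G) p.length y).subset ?_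
    rintro _ ⟨⟨φ, hφ⟩, rfl⟩
    have hφ' : φ y = y := hφ
    exact ⟨(p.map φ.toHom).copy hφ' rfl, by simp⟩
  exact Set.ncard_ne_zero_of_mem (mem_orbit_self x) hfin

lemma isPretransitive_of_isTransitive (h : IsTransitive G) : IsPretransitive (G ≃g G) V :=
  ⟨h⟩

lemma degree_eq_of_isTransitive [G.LocallyFinite] (h : IsTransitive G) (x y : V) :
    G.degree x = G.degree y := by
  obtain ⟨φ, rfl⟩ := h x y
  exact (φ.degree_eq x).symm

lemma isUnimodular_of_modularRatio_eq_one [G.LocallyFinite] (hconn : G.Connected)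
    (htrans : IsTransitive G) (h : ∀ x y : V, modularRatio (G ≃g G) x y = 1) :
    IsUnimodular G := by
  intro f hf o
  have := isPretransitive_of_isTransitive htrans
  have := tsum_mass_transport (Γ := G ≃g G) (relIndex_stabilizer_ne_zero hconn)
    (fun x y => (f x y : ℝ≥0∞)) (fun φ x y => by exact_mod_cast hf φ x y) o
  simpa [h] using this.symm

/-- If `Δ` were `1` on the edges at `x`, it would be `1` on all edges by transitivity, and
everywhere by the cocycle identity along walks. -/
lemma exists_adj_modularRatio_ne_one [G.LocallyFinite] (hconn : G.Connected)
    (htrans : IsTransitive G) (h : ¬ IsUnimodular G) (x : V) :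
    ∃ y, G.Adj x y ∧ modularRatio (G ≃g G) x y ≠ 1 := by
  by_contra! hx
  have hadj : ∀ y z, G.Adj y z → modularRatio (G ≃g G) y z = 1 := by
    intro y z hyz
    obtain ⟨φ, hφ⟩ := htrans y x
    rw [← modularRatio_smul φ]
    change modularRatio _ (φ y) (φ z) = 1
    rw [hφ]
    exact hx _ (hφ ▸ φ.map_adj_iff.2 hyz)
  refine h (isUnimodular_of_modularRatio_eq_one hconn htrans fun y z => ?_)
  obtain ⟨p⟩ := hconn.preconnected y z
  induction p with
  | nil => exact modularRatio_self (relIndex_stabilizer_ne_zero hconn) _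
  | cons hyz _ ih =>
    rw [← modularRatio_mul (relIndex_stabilizer_ne_zero hconn), hadj _ _ hyz, ih, mul_one]

/-- This is the tilted mass transport principle for the indicator of adjacency. -/
lemma sum_neighborFinset_modularRatio [G.LocallyFinite] (hconn : G.Connected)
    (htrans : IsTransitive G) (x : V) :
    ∑ y ∈ G.neighborFinset x, modularRatio (G ≃g G) x y = G.degree x := by
  classical
  have := isPretransitive_of_isTransitive htrans
  have key := tsum_mass_transport (Γ := G ≃g G) (relIndex_stabilizer_ne_zero hconn)
    (fun x y => if G.Adj x y then (1 : ℝ≥0∞) else 0)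
    (fun φ x y => by
      change (if G.Adj (φ x) (φ y) then (1 : ℝ≥0∞) else 0) = _
      simp only [φ.map_adj_iff]) x
  have e1 : ∑' y, (if G.Adj y x then (1 : ℝ≥0∞) else 0) = G.degree x := by
    rw [tsum_eq_sum (s := G.neighborFinset x), Finset.sum_congr rfl (g := fun _ => (1 : ℝ≥0∞)),
      Finset.sum_const, SimpleGraph.card_neighborFinset_eq_degree, nsmul_one]
    · intro y hy
      rw [SimpleGraph.mem_neighborFinset] at hy
      exact if_pos hy.symm
    · intro y hy
      rw [SimpleGraph.mem_neighborFinset] at hy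
      exact if_neg fun h => hy h.symm
  have e2 : ∑' y, (if G.Adj x y then (1 : ℝ≥0∞) else 0) * modularRatio (G ≃g G) x y =
      ∑ y ∈ G.neighborFinset x, (modularRatio (G ≃g G) x y : ℝ≥0∞) := by
    rw [tsum_eq_sum (s := G.neighborFinset x)]
    · refine Finset.sum_congr rfl fun y hy => ?_
      rw [SimpleGraph.mem_neighborFinset] at hy
      rw [if_pos hy, one_mul]
    · intro y hy
      rw [SimpleGraph.mem_neighborFinset] at hy
      rw [if_neg hy, zero_mul]
  rw [e1, e2] at key
  exact_mod_cast key.symm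

/-- A positive function on the vertices which automorphisms scale by constants. -/
def IsScaledByAut (G : SimpleGraph V) (h : V → ℝ≥0) : Prop :=
  (∀ x, h x ≠ 0) ∧ ∀ φ : G ≃g G, ∃ c : ℝ≥0, c ≠ 0 ∧ ∀ x, h (φ x) = c * h x

lemma sqrt_lt_half_add_one {t : ℝ≥0} (ht : t ≠ 1) : NNReal.sqrt t < (1 + t) / 2 := by
  rw [lt_div_iff₀ two_pos, ← NNReal.coe_lt_coe]
  push_cast
  have h0 : (t : ℝ) ≠ 1 := by exact_mod_cast ht
  have h1 := Real.sq_sqrt t.coe_nonneg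
  have h2 : √(t : ℝ) - 1 ≠ 0 := fun h => h0 (by rw [← h1, sub_eq_zero.1 h, one_pow])
  nlinarith [sq_pos_of_ne_zero h2]

lemma exists_scaled_superharmonic [G.LocallyFinite] (hconn : G.Connected)
    (htrans : IsTransitive G) (hG : ¬ IsUnimodular G) :
    ∃ (h : V → ℝ≥0) (c : ℝ≥0), c < 1 ∧ IsScaledByAut G h ∧
      ∀ x, ∑ y ∈ G.neighborFinset x, h y = c * G.degree x * h x := by
  obtain ⟨o⟩ := hconn.nonempty
  have hne := modularRatio_ne_zero (relIndex_stabilizer_ne_zero hconn)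
  have hmul := modularRatio_mul (relIndex_stabilizer_ne_zero hconn)
  obtain ⟨z, hoz, hz⟩ := exists_adj_modularRatio_ne_one hconn htrans hG o
  have hdeg : (G.degree o : ℝ≥0) ≠ 0 := by
    have : 0 < G.degree o := (G.degree_pos_iff_exists_adj o).2 ⟨z, hoz⟩
    positivity
  set s : V → ℝ≥0 := fun x => ∑ y ∈ G.neighborFinset x, NNReal.sqrt (modularRatio (G ≃g G) x y)
  have hs : ∀ x, s x = s o := by
    intro x
    obtain ⟨φ, rfl⟩ := htrans o x
    refine (Finset.sum_bij (fun y _ => φ y) ?_ ?_ ?_ ?_).symm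
    · intro y hy
      rw [SimpleGraph.mem_neighborFinset] at hy ⊢
      exact φ.map_adj_iff.2 hy
    · intro a _ b _ hab
      exact φ.injective hab
    · intro y hy
      rw [SimpleGraph.mem_neighborFinset] at hy
      refine ⟨φ.symm y, ?_, φ.apply_symm_apply y⟩
      rw [SimpleGraph.mem_neighborFinset, ← φ.map_adj_iff, φ.apply_symm_apply]
      exact hy
    · intro y _
      exact congrArg _ (modularRatio_smul φ o y).symm
  -- `Δ(o, ·)` itself has eigenvalue `1` and gives no decay. The square root brings the eigenvalue
  -- strictly below `1`, because AM-GM is strict at the neighbour `z`.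
  refine ⟨fun x => NNReal.sqrt (modularRatio (G ≃g G) o x), s o / G.degree o, ?_,
    ⟨fun x => by simpa using hne o x, fun φ => ?_⟩, fun x => ?_⟩
  · rw [div_lt_one (pos_iff_ne_zero.2 hdeg)]
    have hlt : s o < ∑ y ∈ G.neighborFinset o, (1 + modularRatio (G ≃g G) o y) / 2 := by
      refine Finset.sum_lt_sum (fun y _ => ?_) ⟨z, by simpa using hoz, sqrt_lt_half_add_one hz⟩
      rcases eq_or_ne (modularRatio (G ≃g G) o y) 1 with h | h
      · rw [h]
        norm_num
      · exact (sqrt_lt_half_add_one h).le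
    refine hlt.trans_eq ?_
    rw [← Finset.sum_div, Finset.sum_add_distrib, sum_neighborFinset_modularRatio hconn htrans,
      Finset.sum_const, SimpleGraph.card_neighborFinset_eq_degree, nsmul_one, add_self_div_two]
  -- The scaling factor comes from `Δ(o, φ x) = Δ(o, φ o) Δ(φ o, φ x) = Δ(o, φ o) Δ(o, x)`.
  · refine ⟨NNReal.sqrt (modularRatio (G ≃g G) o (φ o)), by simpa using hne o (φ o), fun x => ?_⟩
    dsimp only
    rw [← NNReal.sqrt_mul, ← hmul o (φ o) (φ x)]
    exact congrArg (fun t => NNReal.sqrt (_ * t)) (modularRatio_smul φ o x)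
  · rw [degree_eq_of_isTransitive htrans x o, div_mul_cancel₀ _ hdeg, ← hs x, Finset.sum_mul]
    refine Finset.sum_congr rfl fun y _ => ?_
    dsimp only
    rw [← hmul o x y, NNReal.sqrt_mul, mul_comm]

end Graph


/-! ### The simple random walk -/

section RandomWalk

variable {V : Type*} [MeasurableSpace V] [DiscreteMeasurableSpace V]
  (G : SimpleGraph V) [G.LocallyFinite]

instance (x : V) : IsProbabilityMeasure (srwLaw G x) :=
  inferInstanceAs (IsProbabilityMeasure
    (Kernel.traj (X := fun _ => V) (srwHistoryKernel G) 0 (fun _ => x)))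

lemma measurableSet_setOf_eval_eq {ι : Type*} (i : ι) (a : V) :
    MeasurableSet {w : ι → V | w i = a} :=
  (measurable_pi_apply (X := fun _ => V) i) (MeasurableSet.singleton a)

/-- The Markov property of the simple random walk at a fixed time. -/
lemma lintegral_srwLaw_succ (x : V) (n : ℕ) {f : (Finset.Iic n → V) × V → ℝ≥0∞}
    (hf : Measurable f) :
    ∫⁻ w, f (Preorder.frestrictLe n w, w (n + 1)) ∂srwLaw G x =
      ∫⁻ w, ∫⁻ y, f (Preorder.frestrictLe n w, y) ∂srwKernel G (w n) ∂srwLaw G x := by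
  have h := Kernel.partialTraj_compProd_eq_map_traj (X := fun _ => V) (κ := srwHistoryKernel G)
    (zero_le : 0 ≤ n) (x₀ := fun _ => x)
  have hm : Measurable fun w : ℕ → V => (Preorder.frestrictLe (π := fun _ => V) n w, w (n + 1)) :=
    by fun_prop
  calc _ = ∫⁻ q, f q ∂((Kernel.traj (X := fun _ => V) (srwHistoryKernel G) 0 (fun _ => x)).map
        fun w => (Preorder.frestrictLe n w, w (n + 1))) := (lintegral_map hf hm).symm
    _ = _ := by
      rw [← h, Measure.lintegral_compProd hf, ← Kernel.traj_map_frestrictLe_apply,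
        lintegral_map hf.lintegral_kernel_prod_right' (by fun_prop)]
      rfl

lemma ae_srwLaw_eval_zero (x : V) : ∀ᵐ w ∂srwLaw G x, w 0 = x := by
  have h := Kernel.traj_map_frestrictLe_apply (X := fun _ => V) (κ := srwHistoryKernel G) 0 0
    (fun _ => x)
  rw [Kernel.partialTraj_self, Kernel.id_apply] at h
  have h2 : ∀ᵐ v ∂((srwLaw G x).map (Preorder.frestrictLe (π := fun _ => V) 0)),
      v ⟨0, by simp⟩ = x := by
    rw [srwLaw, h, ae_dirac_iff]
    exact measurableSet_setOf_eval_eq _ _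
  exact ae_of_ae_map (by fun_prop) h2

lemma measurableSet_setOf_forall_le_eq (n : ℕ) (z : ℕ → V) :
    MeasurableSet {w : ℕ → V | ∀ i ≤ n, w i = z i} := by
  have : {w : ℕ → V | ∀ i ≤ n, w i = z i} = ⋂ i, ⋂ _ : i ≤ n, {w | w i = z i} := by ext; simp
  rw [this]
  exact MeasurableSet.iInter fun i => MeasurableSet.iInter fun _ => measurableSet_setOf_eval_eq i _

lemma srwLaw_forall_le_eq (x : V) (n : ℕ) (z : ℕ → V) (hz : z 0 = x) :
    srwLaw G x {w | ∀ i ≤ n, w i = z i} =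
      ∏ i ∈ Finset.range n, srwKernel G (z i) {z (i + 1)} := by
  induction n with
  | zero =>
    rw [Finset.range_zero, Finset.prod_empty, ← prob_compl_eq_zero_iff
      (measurableSet_setOf_forall_le_eq 0 z)]
    filter_upwards [ae_srwLaw_eval_zero G x] with w hw i hi
    rw [Nat.le_zero.1 hi, hw, hz]
  | succ n ih =>
    set C : Set (Finset.Iic n → V) := {v | ∀ i, v i = z i} with hC
    have hCm : MeasurableSet C := by
      have : C = ⋂ i : Finset.Iic n, {v | v i = z i} := by ext; simp [hC]
      rw [this]
      exact MeasurableSet.iInter fun i => measurableSet_setOf_eval_eq i _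
    have hm : MeasurableSet (C ×ˢ {z (n + 1)}) := hCm.prod MeasurableSet.of_discrete
    have key := lintegral_srwLaw_succ G x n (measurable_const (a := (1 : ℝ≥0∞)) |>.indicator hm)
    have e1 : ∀ w : ℕ → V, (C ×ˢ {z (n + 1)}).indicator (fun _ => (1 : ℝ≥0∞))
        (Preorder.frestrictLe n w, w (n + 1)) =
        {w : ℕ → V | ∀ i ≤ n + 1, w i = z i}.indicator (fun _ => (1 : ℝ≥0∞)) w := by
      intro w
      refine Set.indicator_const_eq_indicator_const ?_
      simp only [Set.mem_prod, hC, Set.mem_ofPred_eq, Set.mem_singleton_iff, Subtype.forall,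
        Finset.mem_Iic, Preorder.frestrictLe_apply]
      refine ⟨fun h i hi => ?_, fun h => ⟨fun i hi => h i (by omega), h _ le_rfl⟩⟩
      rcases Nat.le_succ_iff.1 hi with hi | rfl
      exacts [h.1 i hi, h.2]
    have e2 : ∀ w : ℕ → V, ∫⁻ y, (C ×ˢ {z (n + 1)}).indicator (fun _ => (1 : ℝ≥0∞))
        (Preorder.frestrictLe n w, y) ∂srwKernel G (w n) =
        {w : ℕ → V | ∀ i ≤ n, w i = z i}.indicator
          (fun _ => srwKernel G (z n) {z (n + 1)}) w := by
      intro w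
      by_cases hw : w ∈ {w : ℕ → V | ∀ i ≤ n, w i = z i}
      · rw [Set.indicator_of_mem hw, ← hw n le_rfl,
          ← lintegral_indicator_one (MeasurableSet.of_discrete (s := {z (n + 1)}))]
        refine lintegral_congr fun y => Set.indicator_const_eq_indicator_const ?_
        simp only [Set.mem_prod, and_iff_right_iff_imp]
        exact fun _ i => hw i (Finset.mem_Iic.1 i.2)
      · rw [Set.indicator_of_notMem hw]
        refine (lintegral_congr fun y => Set.indicator_of_notMem ?_ _).trans lintegral_zero
        exact fun hy => hw fun i hi => hy.1 ⟨i, Finset.mem_Iic.2 hi⟩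
    rw [lintegral_congr e1, lintegral_congr e2,
      lintegral_indicator_const (measurableSet_setOf_forall_le_eq _ _), one_mul,
      lintegral_indicator_const (measurableSet_setOf_forall_le_eq _ _), ih] at key
    rw [key, Finset.prod_range_succ, mul_comm]

lemma lintegral_srwLaw_apply (x : V) {h : V → ℝ≥0∞} {c : ℝ≥0∞}
    (hh : ∀ y, ∫⁻ z, h z ∂srwKernel G y = c * h y) (n : ℕ) :
    ∫⁻ w, h (w n) ∂srwLaw G x = c ^ n * h x := by
  have hm : Measurable h := Measurable.of_discrete
  induction n with
  | zero =>
    rw [pow_zero, one_mul, lintegral_congr_ae (g := fun _ => h x)]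
    · simp
    · filter_upwards [ae_srwLaw_eval_zero G x] with w hw
      rw [hw]
  | succ n ih =>
    have key := lintegral_srwLaw_succ G x n (f := fun q => h q.2) (by fun_prop)
    simp only [hh] at key
    rw [key, lintegral_const_mul _ (by fun_prop), ih, pow_succ']
    ring

/-- The expectation of `h (w n)` is `c ^ n * h x`, a summable sequence. So `∑ₙ h (w n)` is almost
surely finite, with finitely many terms above any positive level. -/
lemma ae_srwLaw_finite_setOf_le (x : V) {h : V → ℝ≥0} {c : ℝ≥0∞} (hc : c < 1)
    (hh : ∀ y, ∫⁻ z, h z ∂srwKernel G y = c * h y) :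
    ∀ᵐ w ∂srwLaw G x, ∀ ε : ℝ≥0, ε ≠ 0 → {n : ℕ | ε ≤ h (w n)}.Finite := by
  have hm : Measurable fun x => (h x : ℝ≥0∞) := Measurable.of_discrete
  have hsum : ∫⁻ w, ∑' n : ℕ, (h (w n) : ℝ≥0∞) ∂srwLaw G x ≠ ∞ := by
    rw [lintegral_tsum (f := fun n (w : ℕ → V) => (h (w n) : ℝ≥0∞))
      fun n => (hm.comp (measurable_pi_apply n)).aemeasurable]
    simp_rw [lintegral_srwLaw_apply G x hh]
    rw [ENNReal.tsum_mul_right, ENNReal.tsum_geometric]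
    exact ENNReal.mul_ne_top (ENNReal.inv_ne_top.2 (tsub_pos_of_lt hc).ne') ENNReal.coe_ne_top
  filter_upwards [ae_lt_top (Measurable.tsum fun n =>
    hm.comp (measurable_pi_apply n)) hsum] with w hw ε hε
  have := ENNReal.finite_const_le_of_tsum_ne_top hw.ne (ε := ε) (by exact_mod_cast hε)
  simpa using this

lemma srwKernel_singleton_of_not_adj {x y : V} (hx : ∃ z, G.Adj x z) (hxy : ¬ G.Adj x y) :
    srwKernel G x {y} = 0 := by
  have hne : (G.neighborFinset x).Nonempty := by
    obtain ⟨z, hz⟩ := hx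
    exact ⟨z, by simpa using hz⟩
  change (srwStep G x).toMeasure {y} = 0
  rw [PMF.toMeasure_apply_singleton _ _ MeasurableSet.of_discrete, srwStep, dif_pos hne,
    PMF.uniformOfFinset_apply_of_notMem]
  simpa using hxy

lemma srwKernel_singleton_of_adj {x y : V} (hxy : G.Adj x y) :
    srwKernel G x {y} = (G.degree x : ℝ≥0∞)⁻¹ := by
  have hne : (G.neighborFinset x).Nonempty := ⟨y, by simpa using hxy⟩
  change (srwStep G x).toMeasure {y} = _
  rw [PMF.toMeasure_apply_singleton _ _ MeasurableSet.of_discrete, srwStep, dif_pos hne,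
    PMF.uniformOfFinset_apply_of_mem]
  · rfl
  · simpa using hxy

lemma lintegral_srwKernel [Countable V] {x : V} (hx : ∃ z, G.Adj x z) (f : V → ℝ≥0∞) :
    ∫⁻ y, f y ∂srwKernel G x = (∑ y ∈ G.neighborFinset x, f y) / G.degree x := by
  rw [lintegral_countable', tsum_eq_sum (s := G.neighborFinset x), div_eq_mul_inv, Finset.sum_mul]
  · refine Finset.sum_congr rfl fun y hy => ?_
    rw [srwKernel_singleton_of_adj G (by simpa using hy)]
  · intro y hy
    rw [srwKernel_singleton_of_not_adj G hx (by simpa using hy), mul_zero]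

lemma ae_srwLaw_adj [Countable V] (hG : ∀ x, ∃ z, G.Adj x z) (x : V) :
    ∀ᵐ w ∂srwLaw G x, ∀ n : ℕ, G.Adj (w n) (w (n + 1)) := by
  refine ae_all_iff.2 fun n => ?_
  have hS : MeasurableSet {q : V × V | ¬ G.Adj q.1 q.2} := MeasurableSet.of_discrete
  have hm : Measurable fun q : (Finset.Iic n → V) × V =>
      (q.1 ⟨n, Finset.mem_Iic.2 le_rfl⟩, q.2) := by fun_prop
  have key := lintegral_srwLaw_succ G x n (measurable_const (a := (1 : ℝ≥0∞)) |>.indicator (hm hS))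
  have hm' : Measurable fun w : ℕ → V => (w n, w (n + 1)) := by fun_prop
  have e1 : ∫⁻ w, ((fun q : (Finset.Iic n → V) × V =>
      (q.1 ⟨n, Finset.mem_Iic.2 le_rfl⟩, q.2)) ⁻¹' {q : V × V | ¬ G.Adj q.1 q.2}).indicator
        (fun _ => (1 : ℝ≥0∞)) (Preorder.frestrictLe n w, w (n + 1)) ∂srwLaw G x =
      srwLaw G x {w | ¬ G.Adj (w n) (w (n + 1))} := by
    exact (lintegral_indicator_const (hm' hS) 1).trans (one_mul _)
  rw [e1] at key
  rw [ae_iff, key]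
  refine (lintegral_congr fun w => ?_).trans lintegral_zero
  rw [lintegral_srwKernel G (hG _), Finset.sum_eq_zero, ENNReal.zero_div]
  intro y hy
  refine Set.indicator_of_notMem (not_not_intro ?_) _
  simpa using hy

/-- An isolated vertex would be the whole graph and the walk would sit there forever. This rules out
the fallback case of `srwStep`. -/
lemma exists_adj_of_isTransient (hconn : G.Connected) (ht : IsTransient G) (x : V) :
    ∃ z, G.Adj x z := by
  by_contra! hx
  have hall : ∀ y, y = x := by
    intro y
    obtain ⟨p⟩ := hconn.preconnected x y
    cases p with
    | nil => rfl
    | cons h _ => exact absurd h (hx _)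
  obtain ⟨w, hw⟩ := (ht x).exists
  have : {n : ℕ | w n = x} = Set.univ := Set.eq_univ_of_forall fun n => hall _
  exact Set.infinite_univ (this ▸ hw x)

end RandomWalk


/-! ### The doubly infinite simple random walk on paths indexed by `ℤ` -/

section TwoSided

variable {V : Type*}

/-- The cylinder of the bi-infinite paths which agree with `z` on `[-m, n]`. -/
def intCylinder (m n : ℕ) (z : ℤ → V) : Set (ℤ → V) :=
  {w | ∀ k : ℤ, -m ≤ k → k ≤ n → w k = z k}

variable [MeasurableSpace V] [DiscreteMeasurableSpace V]

lemma measurableSet_intCylinder (m n : ℕ) (z : ℤ → V) : MeasurableSet (intCylinder m n z) := by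
  have : intCylinder m n z = ⋂ k : ℤ, ⋂ _ : -m ≤ k, ⋂ _ : k ≤ n, {w | w k = z k} := by
    ext; simp [intCylinder]
  rw [this]
  exact MeasurableSet.iInter fun i => MeasurableSet.iInter fun _ => MeasurableSet.iInter fun _ =>
    measurableSet_setOf_eval_eq i _

/-- Windows `[-(n+1), n+1]` suffice as a generating π-system. The `+ 1` ensures that a window still
contains time `0` after a shift by one, as the product formula for cylinders requires. -/
lemma ext_of_intCylinder [Countable V] [Nonempty V] {μ ν : Measure (ℤ → V)}
    (hfin : ∀ z, μ (intCylinder 1 1 z) ≠ ∞)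
    (h : ∀ n z, μ (intCylinder (n + 1) (n + 1) z) = ν (intCylinder (n + 1) (n + 1) z)) :
    μ = ν := by
  obtain ⟨o⟩ := ‹Nonempty V›
  -- Padding finite words with `o` leaves only countably many cylinders per window.
  let ext (n : ℕ) (t : Finset.Icc (-(n + 1) : ℤ) (n + 1) → V) (k : ℤ) : V :=
    if hk : k ∈ Finset.Icc (-(n + 1) : ℤ) (n + 1) then t ⟨k, hk⟩ else o
  have hext : ∀ n (w : ℤ → V), w ∈ intCylinder (n + 1) (n + 1) (ext n fun k => w k) := by
    intro n w k hk1 hk2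
    have hk : k ∈ Finset.Icc (-(n + 1) : ℤ) (n + 1) := by
      rw [Finset.mem_Icc]; push_cast at hk1 hk2; exact ⟨hk1, hk2⟩
    simp only [ext, dif_pos hk]
  refine Measure.ext_of_generateFrom_of_cover_subset
    (S := {s | ∃ n z, s = intCylinder (n + 1) (n + 1) z})
    (T := Set.range fun t => intCylinder 1 1 (ext 0 t)) ?_ ?_ ?_ (Set.countable_range _) ?_ ?_ ?_
  · refine le_antisymm ?_ (MeasurableSpace.generateFrom_le ?_)
    · refine iSup_le fun k => ?_
      rintro _ ⟨A, -, rfl⟩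
      have hA : (fun w : ℤ → V => w k) ⁻¹' A =
          ⋃ t ∈ {t | ext k.natAbs t k ∈ A},
            intCylinder (k.natAbs + 1) (k.natAbs + 1) (ext k.natAbs t) := by
        ext w
        simp only [Set.mem_preimage, Set.mem_iUnion, exists_prop]
        constructor
        · intro hw
          refine ⟨fun k => w k, ?_, hext _ w⟩
          have := hext k.natAbs w k (by omega) (by omega)
          rw [Set.mem_ofPred_eq, ← this]
          exact hw
        · rintro ⟨t, ht, hw⟩
          rw [hw k (by omega) (by omega)]
          exact ht
      rw [hA]
      exact MeasurableSet.biUnion (Set.to_countable _) fun t _ =>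
        MeasurableSpace.measurableSet_generateFrom ⟨_, _, rfl⟩
    · rintro _ ⟨n, z, rfl⟩
      exact measurableSet_intCylinder _ _ _
  · rintro _ ⟨n, z, rfl⟩ _ ⟨n', z', rfl⟩ ⟨w, hw, hw'⟩
    refine ⟨max n n', w, ?_⟩
    ext v
    constructor
    · rintro ⟨hv, hv'⟩ k hk1 hk2
      by_cases hk : -((n + 1 : ℕ) : ℤ) ≤ k ∧ k ≤ (n + 1 : ℕ)
      · rw [hv k hk.1 hk.2, hw k hk.1 hk.2]
      · have hk' : -((n' + 1 : ℕ) : ℤ) ≤ k ∧ k ≤ (n' + 1 : ℕ) := by omega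
        rw [hv' k hk'.1 hk'.2, hw' k hk'.1 hk'.2]
    · intro hv
      refine ⟨fun k hk1 hk2 => ?_, fun k hk1 hk2 => ?_⟩
      · rw [hv k (by omega) (by omega), hw k hk1 hk2]
      · rw [hv k (by omega) (by omega), hw' k hk1 hk2]
  · rintro _ ⟨t, rfl⟩
    exact ⟨0, _, rfl⟩
  · refine Set.eq_univ_of_forall fun w => ⟨_, ⟨fun k => w k, rfl⟩, hext 0 w⟩
  · rintro _ ⟨t, rfl⟩
    exact hfin _
  · rintro _ ⟨n, z, rfl⟩
    exact h n z

variable (G : SimpleGraph V) [G.LocallyFinite]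

/-- The law on `ℤ → V` of the doubly infinite simple random walk from `x`. -/
def intLaw (x : V) : Measure (ℤ → V) :=
  ((srwLaw G x).prod (srwLaw G x)).map glue

instance (x : V) : IsProbabilityMeasure (intLaw G x) :=
  Measure.isProbabilityMeasure_map measurable_glue.aemeasurable

lemma measurePreserving_intLaw_forward (x : V) :
    MeasurePreserving (fun (w : ℤ → V) (n : ℕ) => w n) (intLaw G x) (srwLaw G x) := by
  have hm : Measurable fun (w : ℤ → V) (n : ℕ) => w n := by fun_prop
  refine ⟨hm, ?_⟩
  rw [intLaw, Measure.map_map hm measurable_glue]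
  have : (fun (w : ℤ → V) (n : ℕ) => w n) ∘ glue = Prod.fst := by
    ext p n
    simp [glue]
  rw [this]
  exact measurePreserving_fst.map_eq

lemma measurePreserving_intLaw_backward (x : V) :
    MeasurePreserving (fun (w : ℤ → V) (n : ℕ) => w (-n)) (intLaw G x) (srwLaw G x) := by
  have hm : Measurable fun (w : ℤ → V) (n : ℕ) => w (-n) := by fun_prop
  refine ⟨hm, ?_⟩
  rw [intLaw, Measure.map_map hm measurable_glue]
  -- The equality is only almost sure: `glue` reads time `0` from the forward path, and both paths
  -- start at `x` almost surely.
  have : (fun (w : ℤ → V) (n : ℕ) => w (-n)) ∘ glue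
      =ᵐ[(srwLaw G x).prod (srwLaw G x)] Prod.snd := by
    filter_upwards [Measure.quasiMeasurePreserving_fst.ae (ae_srwLaw_eval_zero G x),
      Measure.quasiMeasurePreserving_snd.ae (ae_srwLaw_eval_zero G x)] with p hp1 hp2
    ext n
    rcases Nat.eq_zero_or_pos n with rfl | hn
    · simp [glue, hp1, hp2]
    · simp [glue, hn.ne']
  rw [Measure.map_congr this]
  exact measurePreserving_snd.map_eq

lemma ae_intLaw {x : V} {P : (ℕ → V) → Prop} (hP : ∀ᵐ w ∂srwLaw G x, P w) :
    ∀ᵐ w ∂intLaw G x, P (fun n => w n) ∧ P (fun n => w (-n)) :=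
  ((measurePreserving_intLaw_forward G x).quasiMeasurePreserving.ae hP).and
    ((measurePreserving_intLaw_backward G x).quasiMeasurePreserving.ae hP)

lemma ae_intLaw_eval_zero (x : V) : ∀ᵐ w ∂intLaw G x, w 0 = x := by
  filter_upwards [ae_intLaw G (ae_srwLaw_eval_zero G x)] with w hw
  exact hw.1

lemma intLaw_intCylinder {x : V} (m n : ℕ) {z : ℤ → V} (hz : z 0 = x) :
    intLaw G x (intCylinder m n z) =
      (∏ i ∈ Finset.range n, srwKernel G (z i) {z (i + 1)}) *
        ∏ i ∈ Finset.range m, srwKernel G (z (-i)) {z (-i - 1)} := by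
  have hae : (glue ⁻¹' intCylinder m n z : Set ((ℕ → V) × (ℕ → V)))
      =ᵐ[(srwLaw G x).prod (srwLaw G x)]
      {w | ∀ i ≤ n, w i = z i} ×ˢ {w | ∀ i ≤ m, w i = z (-i)} := by
    filter_upwards [Measure.quasiMeasurePreserving_fst.ae (ae_srwLaw_eval_zero G x),
      Measure.quasiMeasurePreserving_snd.ae (ae_srwLaw_eval_zero G x)] with p hp1 hp2
    refine propext ⟨fun hp => ⟨fun i hi => ?_, fun i hi => ?_⟩, fun hp k hk1 hk2 => ?_⟩
    · have := hp (i : ℤ) (by omega) (by omega)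
      simpa [glue] using this
    · rcases Nat.eq_zero_or_pos i with rfl | hi0
      · simp [hp2, hz]
      · have := hp (-i : ℤ) (by omega) (by omega)
        simpa [glue, hi0.ne'] using this
    · by_cases hk : 0 ≤ k
      · have := hp.1 k.toNat (by omega)
        rw [Int.toNat_of_nonneg hk] at this
        simpa [glue, hk] using this
      · have := hp.2 (-k).toNat (by omega)
        rw [Int.toNat_of_nonneg (by omega), neg_neg] at this
        simpa [glue, hk] using this
  rw [intLaw, Measure.map_apply measurable_glue (measurableSet_intCylinder m n z),
    measure_congr hae, Measure.prod_prod, srwLaw_forall_le_eq G x n (fun i => z i) hz,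
    srwLaw_forall_le_eq G x m (fun i => z (-i)) (by simpa using hz)]
  congr 1
  refine Finset.prod_congr rfl fun i _ => ?_
  push_cast
  rw [neg_add']

/-- The sum over all starting points of the laws of the doubly infinite random walk. -/
def totalIntLaw : Measure (ℤ → V) := Measure.sum (intLaw G)

/-- Only the starting point `z 0` contributes, so the weight of a finite path is the product of its
transition probabilities, directed away from time `0`. -/
lemma totalIntLaw_intCylinder [Countable V] (m n : ℕ) (z : ℤ → V) :
    totalIntLaw G (intCylinder m n z) =
      (∏ i ∈ Finset.range n, srwKernel G (z i) {z (i + 1)}) *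
        ∏ i ∈ Finset.range m, srwKernel G (z (-i)) {z (-i - 1)} := by
  rw [totalIntLaw, Measure.sum_apply_of_countable, tsum_eq_single (z 0),
    intLaw_intCylinder G m n rfl]
  intro x hx
  refine measure_mono_null (t := {w | ¬ w 0 = x}) (fun w hw h => hx ?_)
    (ae_iff.1 (ae_intLaw_eval_zero G x))
  rw [← h, hw 0 (by omega) (by omega)]

lemma totalIntLaw_intCylinder_ne_top [Countable V] (m n : ℕ) (z : ℤ → V) :
    totalIntLaw G (intCylinder m n z) ≠ ∞ := by
  rw [totalIntLaw_intCylinder]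
  exact ENNReal.mul_ne_top (ENNReal.prod_ne_top fun _ _ => measure_ne_top _ _)
    (ENNReal.prod_ne_top fun _ _ => measure_ne_top _ _)

variable {G} in
/-- Reversibility of the simple random walk on a regular graph. -/
lemma srwKernel_singleton_comm (htrans : IsTransitive G) (hG : ∀ x, ∃ z, G.Adj x z) (x y : V) :
    srwKernel G x {y} = srwKernel G y {x} := by
  by_cases h : G.Adj x y
  · rw [srwKernel_singleton_of_adj G h, srwKernel_singleton_of_adj G h.symm,
      degree_eq_of_isTransitive htrans]
  · rw [srwKernel_singleton_of_not_adj G (hG x) h,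
      srwKernel_singleton_of_not_adj G (hG y) fun h' => h h'.symm]

variable {G} in
lemma srwKernel_singleton_apply_aut (hG : ∀ x, ∃ z, G.Adj x z) (φ : G ≃g G) (x y : V) :
    srwKernel G (φ x) {φ y} = srwKernel G x {y} := by
  by_cases h : G.Adj x y
  · rw [srwKernel_singleton_of_adj G h, srwKernel_singleton_of_adj G (φ.map_adj_iff.2 h),
      φ.degree_eq]
  · rw [srwKernel_singleton_of_not_adj G (hG x) h,
      srwKernel_singleton_of_not_adj G (hG (φ x)) fun h' => h (φ.map_adj_iff.1 h')]

variable {G} in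
lemma measurePreserving_totalIntLaw_shift [Countable V] [Nonempty V]
    (htrans : IsTransitive G) (hG : ∀ x, ∃ z, G.Adj x z) :
    MeasurePreserving (fun (w : ℤ → V) (k : ℤ) => w (k + 1)) (totalIntLaw G) (totalIntLaw G) := by
  have hm : Measurable fun (w : ℤ → V) (k : ℤ) => w (k + 1) := by fun_prop
  refine ⟨hm, (ext_of_intCylinder (fun z => totalIntLaw_intCylinder_ne_top G _ _ z)
    fun n z => ?_).symm⟩
  rw [Measure.map_apply hm (measurableSet_intCylinder _ _ _)]
  have : (fun (w : ℤ → V) (k : ℤ) => w (k + 1)) ⁻¹' intCylinder (n + 1) (n + 1) z =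
      intCylinder n (n + 2) fun k => z (k - 1) := by
    ext w
    refine ⟨fun hw k hk1 hk2 => ?_, fun hw k hk1 hk2 => ?_⟩
    · have := hw (k - 1) (by omega) (by omega)
      simpa using this
    · have := hw (k + 1) (by omega) (by omega)
      simpa using this
  -- The shift moves the edge between `z (-1)` and `z 0` from the backward product to the forward
  -- one. Reversibility says that its factor is the same in both directions.
  rw [this, totalIntLaw_intCylinder, totalIntLaw_intCylinder,
    Finset.prod_range_succ' _ (n + 1),
    Finset.prod_range_succ' (fun i : ℕ => srwKernel G (z (-i)) {z (-i - 1)}) n, mul_assoc]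
  congr 1
  · refine Finset.prod_congr rfl fun i _ => ?_
    push_cast
    congr 3 <;> ring
  · rw [mul_comm]
    congr 1
    · simp [srwKernel_singleton_comm htrans hG (z 0)]
    · refine Finset.prod_congr rfl fun i _ => ?_
      push_cast
      congr 3 <;> ring

variable {G} in
lemma measurePreserving_totalIntLaw_aut [Countable V] [Nonempty V]
    (hG : ∀ x, ∃ z, G.Adj x z) (φ : G ≃g G) :
    MeasurePreserving (fun (w : ℤ → V) (k : ℤ) => φ (w k)) (totalIntLaw G) (totalIntLaw G) := by
  have hφ : Measurable φ := Measurable.of_discrete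
  have hm : Measurable fun (w : ℤ → V) (k : ℤ) => φ (w k) := by fun_prop
  refine ⟨hm, (ext_of_intCylinder (fun z => totalIntLaw_intCylinder_ne_top G _ _ z)
    fun n z => ?_).symm⟩
  rw [Measure.map_apply hm (measurableSet_intCylinder _ _ _)]
  have : (fun (w : ℤ → V) (k : ℤ) => φ (w k)) ⁻¹' intCylinder (n + 1) (n + 1) z =
      intCylinder (n + 1) (n + 1) fun k => φ.symm (z k) := by
    ext w
    refine forall_congr' fun k => forall_congr' fun _ => forall_congr' fun _ => ?_
    exact (φ.toEquiv.eq_symm_apply).symm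
  rw [this, totalIntLaw_intCylinder, totalIntLaw_intCylinder]
  simp only [srwKernel_singleton_apply_aut hG φ.symm]

end TwoSided


/-! ### The shift-invariant measure on trajectories -/

section TrajectoryMeasure

variable {V : Type*} {G : SimpleGraph V}

/-- The time shift on trajectories. -/
def Trajectory.shift (k : ℤ) (w : Trajectory G) : Trajectory G :=
  ⟨fun n => w (n + k), fun n => by
    have := w.2.1 (n + k)
    rwa [add_right_comm] at this, fun x =>
    (w.2.2 x).preimage ((add_left_injective k).injOn)⟩

lemma Trajectory.shift_apply (k n : ℤ) (w : Trajectory G) : w.shift k n = w (n + k) := rfl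

lemma Trajectory.ext' {v w : Trajectory G} (h : ∀ n : ℤ, v n = w n) : v = w :=
  Subtype.ext (funext h)

lemma Trajectory.shift_shift (k l : ℤ) (w : Trajectory G) :
    (w.shift k).shift l = w.shift (l + k) :=
  Trajectory.ext' fun n => by simp only [shift_apply, add_assoc]

lemma Trajectory.shift_zero (w : Trajectory G) : w.shift 0 = w :=
  Trajectory.ext' fun n => by simp only [shift_apply, add_zero]

lemma Trajectory.shift_neg_shift (k : ℤ) (w : Trajectory G) : (w.shift k).shift (-k) = w := by
  rw [shift_shift, neg_add_cancel, shift_zero]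

lemma proj_shift (k : ℤ) (w : Trajectory G) : proj G (w.shift k) = proj G w :=
  Quotient.sound ⟨k, fun _ => rfl⟩

lemma Trajectory.act_act_symm (φ : G ≃g G) (w : Trajectory G) : act φ (act φ.symm w) = w :=
  Trajectory.ext' fun _ => φ.apply_symm_apply _

lemma Trajectory.act_symm_act (φ : G ≃g G) (w : Trajectory G) : act φ.symm (act φ w) = w :=
  Trajectory.ext' fun _ => φ.symm_apply_apply _

lemma Trajectory.act_image (φ : G ≃g G) (B : Set (Trajectory G)) :
    act φ '' B = act φ.symm ⁻¹' B :=
  congrFun (Set.image_eq_preimage_of_inverse (act_symm_act φ) (act_act_symm φ)) B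

variable [MeasurableSpace V]

lemma measurable_proj : Measurable (proj G) := fun _ h => h

@[fun_prop]
lemma measurable_trajectory_apply (n : ℤ) : Measurable fun w : Trajectory G => w n :=
  (measurable_pi_apply n).comp measurable_subtype_coe

lemma measurable_shift (k : ℤ) : Measurable (Trajectory.shift (G := G) k) :=
  Measurable.subtype_mk (measurable_pi_iff.2 fun n => measurable_trajectory_apply (n + k))

variable [DiscreteMeasurableSpace V]

/-- This guarantees that `Measure.comap` along the inclusion is not its default value `0`.
Finiteness of the visits to `x` is a countable union over the finite subsets of `ℤ`. -/
lemma measurableEmbedding_trajectory_coe [Countable V] :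
    MeasurableEmbedding fun w : Trajectory G => (w : ℤ → V) := by
  refine MeasurableEmbedding.subtype_coe (s := {w : ℤ → V | (∀ n, G.Adj (w n) (w (n + 1))) ∧
    ∀ x, {n : ℤ | w n = x}.Finite}) ?_
  have e : {w : ℤ → V | (∀ n, G.Adj (w n) (w (n + 1))) ∧ ∀ x, {n : ℤ | w n = x}.Finite} =
      (⋂ n : ℤ, (fun w => (w n, w (n + 1))) ⁻¹' {q | G.Adj q.1 q.2}) ∩
        ⋂ x : V, ⋃ N : Finset ℤ, ⋂ n : ℤ, ⋂ _ : n ∉ N, {w | w n = x}ᶜ := by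
    ext w
    simp only [Set.mem_ofPred_eq, Set.mem_inter_iff, Set.mem_iInter, Set.mem_preimage,
      Set.mem_iUnion, Set.mem_compl_iff]
    refine and_congr_right fun _ => forall_congr' fun x => ⟨fun h => ?_, ?_⟩
    · exact ⟨h.toFinset, fun n hn => by simpa using hn⟩
    · rintro ⟨N, hN⟩
      refine N.finite_toSet.subset fun n hn => ?_
      by_contra h
      exact hN n h hn
  rw [e]
  refine (MeasurableSet.iInter fun n => ?_).inter (MeasurableSet.iInter fun x =>
    MeasurableSet.iUnion fun N => MeasurableSet.iInter fun n => MeasurableSet.iInter fun _ =>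
      (measurableSet_setOf_eval_eq n x).compl)
  have hm : Measurable fun w : ℤ → V => (w n, w (n + 1)) := by fun_prop
  exact hm MeasurableSet.of_discrete

variable (G) [G.LocallyFinite]

/-- The sum over all starting points of the laws of the doubly infinite random walk, viewed as a
measure on trajectories. -/
def totalLaw : Measure (Trajectory G) :=
  Measure.comap (fun w : Trajectory G => (w : ℤ → V)) (totalIntLaw G)

lemma twoSidedLaw_apply [Countable V] (x : V) (B : Set (Trajectory G)) :
    twoSidedLaw G x B = intLaw G x ((fun w : Trajectory G => (w : ℤ → V)) '' B) :=
  measurableEmbedding_trajectory_coe.comap_apply _ _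

lemma totalLaw_apply [Countable V] (B : Set (Trajectory G)) :
    totalLaw G B = ∑' x, twoSidedLaw G x B := by
  simp only [twoSidedLaw_apply]
  rw [totalLaw, measurableEmbedding_trajectory_coe.comap_apply, totalIntLaw,
    Measure.sum_apply_of_countable]

variable {G}

lemma ae_intLaw_mem_range (hG : ∀ x, ∃ z, G.Adj x z) (ht : IsTransient G) (x : V) [Countable V] :
    ∀ᵐ w ∂intLaw G x, w ∈ Set.range fun w : Trajectory G => (w : ℤ → V) := by
  filter_upwards [ae_intLaw G (ae_srwLaw_adj G hG x), ae_intLaw G (ht x)] with w h1 h2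
  refine ⟨⟨w, fun n => ?_, fun y => ?_⟩, rfl⟩
  · obtain ⟨m, rfl | rfl⟩ := n.eq_nat_or_neg
    · exact_mod_cast h1.1 m
    · rcases m with _ | m
      · exact_mod_cast h1.1 0
      · have := (h1.2 m).symm
        rwa [show -((m + 1 : ℕ) : ℤ) + 1 = -m by push_cast; ring]
  · refine (((h2.1 y).image fun n : ℕ => (n : ℤ)).union
      ((h2.2 y).image fun n : ℕ => (-n : ℤ))).subset fun n hn => ?_
    obtain ⟨m, rfl | rfl⟩ := n.eq_nat_or_neg
    · exact Or.inl ⟨m, hn, rfl⟩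
    · exact Or.inr ⟨m, hn, rfl⟩

lemma twoSidedLaw_univ [Countable V] (hG : ∀ x, ∃ z, G.Adj x z) (ht : IsTransient G) (x : V) :
    twoSidedLaw G x Set.univ = 1 := by
  rw [twoSidedLaw_apply, Set.image_univ,
    ← mem_ae_iff_prob_eq_one measurableEmbedding_trajectory_coe.measurableSet_range]
  exact ae_intLaw_mem_range hG ht x

lemma twoSidedLaw_setOf_eval_zero_ne [Countable V] (x : V) :
    twoSidedLaw G x {w | w 0 ≠ x} = 0 := by
  rw [twoSidedLaw_apply]
  refine measure_mono_null ?_ (ae_iff.1 (ae_intLaw_eval_zero G x))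
  rintro _ ⟨w, hw, rfl⟩
  exact hw

lemma ae_totalLaw [Countable V] {P : (ℕ → V) → Prop} (hP : ∀ x, ∀ᵐ w ∂srwLaw G x, P w) :
    ∀ᵐ w ∂totalLaw G, P (fun n => w n) ∧ P (fun n => w (-n)) := by
  have h : ∀ᵐ w ∂totalIntLaw G, P (fun n => w n) ∧ P (fun n => w (-n)) := by
    rw [totalIntLaw, Measure.ae_sum_iff]
    exact fun x => ae_intLaw G (hP x)
  refine ae_of_ae_map (f := fun w : Trajectory G => (w : ℤ → V))
    measurableEmbedding_trajectory_coe.measurable.aemeasurable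
    (p := fun w => P (fun n => w n) ∧ P (fun n => w (-n))) ?_
  rw [totalLaw, measurableEmbedding_trajectory_coe.map_comap]
  exact ae_restrict_of_ae h

/-- Transfers invariance from `ℤ → V` to `W`. The hypothesis `hrange` says that `S` maps no path
outside `W` into `W`, so no mass enters from outside. -/
lemma measurePreserving_totalLaw_of_semiconj [Countable V] {T : Trajectory G → Trajectory G}
    {S : (ℤ → V) → ℤ → V} (hS : MeasurePreserving S (totalIntLaw G) (totalIntLaw G))
    (hST : ∀ w : Trajectory G, S w = T w)
    (hrange : ∀ w (v : Trajectory G), S w = v → ∃ u : Trajectory G, (u : ℤ → V) = w) :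
    MeasurePreserving T (totalLaw G) (totalLaw G) := by
  have hemb := measurableEmbedding_trajectory_coe (G := G)
  have hT : Measurable T := by
    rw [← hemb.measurable_comp_iff]
    have := hS.measurable.comp hemb.measurable
    rwa [show S ∘ (fun w : Trajectory G => (w : ℤ → V)) = (fun w : Trajectory G => (w : ℤ → V)) ∘ T from
      funext hST] at this
  refine ⟨hT, Measure.ext fun B hB => ?_⟩
  rw [Measure.map_apply hT hB, totalLaw, hemb.comap_apply, hemb.comap_apply,
    ← hS.measure_preimage (hemb.measurableSet_image.2 hB).nullMeasurableSet]
  congr 1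
  ext w
  constructor
  · rintro ⟨w, hw, rfl⟩
    exact ⟨T w, hw, (hST w).symm⟩
  · rintro ⟨v, hv, hvw⟩
    obtain ⟨u, rfl⟩ := hrange w v hvw.symm
    refine ⟨u, ?_, rfl⟩
    have : T u = v := Subtype.ext ((hST u).symm.trans hvw.symm)
    rwa [Set.mem_preimage, this]

lemma measurePreserving_act [Countable V] [Nonempty V] (hG : ∀ x, ∃ z, G.Adj x z) (φ : G ≃g G) :
    MeasurePreserving (Trajectory.act φ) (totalLaw G) (totalLaw G) := by
  refine measurePreserving_totalLaw_of_semiconj (measurePreserving_totalIntLaw_aut hG φ)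
    (fun _ => rfl) fun w v h => ⟨Trajectory.act φ.symm v, funext fun n => ?_⟩
  change φ.symm (v n) = w n
  rw [← h, RelIso.symm_apply_apply]

lemma measurePreserving_shift_one [Countable V] [Nonempty V] (htrans : IsTransitive G)
    (hG : ∀ x, ∃ z, G.Adj x z) :
    MeasurePreserving (Trajectory.shift (G := G) 1) (totalLaw G) (totalLaw G) := by
  refine measurePreserving_totalLaw_of_semiconj (measurePreserving_totalIntLaw_shift htrans hG)
    (fun _ => rfl) fun w v h => ⟨Trajectory.shift (-1) v, funext fun n => ?_⟩
  change v (n + -1) = w n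
  rw [← h]
  exact congrArg w (neg_add_cancel_right n 1)

lemma measurePreserving_shift [Countable V] [Nonempty V] (htrans : IsTransitive G)
    (hG : ∀ x, ∃ z, G.Adj x z) (k : ℤ) :
    MeasurePreserving (Trajectory.shift (G := G) k) (totalLaw G) (totalLaw G) := by
  have hadd : ∀ k l : ℤ, Trajectory.shift (G := G) k ∘ Trajectory.shift l =
      Trajectory.shift (k + l) := fun k l => funext fun w => Trajectory.shift_shift l k w
  have hneg : MeasurePreserving (Trajectory.shift (G := G) (-1)) (totalLaw G) (totalLaw G) := by
    refine ⟨measurable_shift _, ?_⟩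
    conv_lhs => rw [← (measurePreserving_shift_one htrans hG).map_eq]
    rw [Measure.map_map (measurable_shift _) (measurable_shift _), hadd, neg_add_cancel,
      show Trajectory.shift (G := G) 0 = id from funext Trajectory.shift_zero, Measure.map_id]
  induction k with
  | zero =>
    rw [show Trajectory.shift (G := G) 0 = id from funext Trajectory.shift_zero]
    exact MeasurePreserving.id _
  | succ n ih =>
    rw [← hadd]
    exact ih.comp (measurePreserving_shift_one htrans hG)
  | pred n ih =>
    rw [sub_eq_add_neg, ← hadd]
    exact ih.comp hneg

end TrajectoryMeasure


/-! ### Sections of the time shift and the interlacement measure -/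

section Selection

variable {V : Type*} {G : SimpleGraph V}

lemma existsUnique_shift_mem_firstEntranceZero (K : Finset V) (w : Trajectory G)
    (hw : ∃ n : ℤ, w n ∈ K) : ∃! k : ℤ, w.shift k ∈ firstEntranceZero G K := by
  have hfin : {n : ℤ | w n ∈ K}.Finite := by
    refine (K.finite_toSet.biUnion fun x _ => w.2.2 x).subset fun n hn => ?_
    exact Set.mem_biUnion (x := w n) hn rfl
  have hiff : ∀ k : ℤ, w.shift k ∈ firstEntranceZero G K ↔ IsLeast {n : ℤ | w n ∈ K} k := by
    intro k
    constructor
    · rintro ⟨h1, h2⟩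
      refine ⟨by simpa [Trajectory.shift_apply] using h1, fun n hn => ?_⟩
      have := h2 (a := n - k) (by simpa [Trajectory.shift_apply] using hn)
      omega
    · rintro ⟨h1, h2⟩
      refine ⟨by simpa [Trajectory.shift_apply] using h1, fun n hn => ?_⟩
      have := h2 (a := n + k) hn
      omega
  simp only [hiff]
  obtain ⟨k, hk, hle⟩ := Set.exists_min_image _ id hfin hw
  exact ⟨k, ⟨hk, fun n hn => hle n hn⟩, fun l hl => hl.unique ⟨hk, fun n hn => hle n hn⟩⟩

/-- The trajectories which attain the maximum of `g` for the first time at time `0`. -/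
def firstArgmaxZero {α : Type*} [LinearOrder α] (G : SimpleGraph V) (g : V → α) :
    Set (Trajectory G) :=
  {w | (∀ n : ℤ, g (w n) ≤ g (w 0)) ∧ ∀ n : ℤ, n < 0 → g (w n) < g (w 0)}

/-- One finite upper level set forces the maximum to be attained, and only finitely often; the
required shift moves the earliest such time to `0`. -/
lemma existsUnique_shift_mem_firstArgmaxZero {α : Type*} [LinearOrder α] (g : V → α)
    (w : Trajectory G) (hw : ∃ m : ℤ, {n : ℤ | g (w m) ≤ g (w n)}.Finite) :
    ∃! k : ℤ, w.shift k ∈ firstArgmaxZero G g := by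
  obtain ⟨m, hm⟩ := hw
  obtain ⟨a, ha, hamax⟩ := Set.exists_max_image _ (fun n => g (w n)) hm ⟨m, le_rfl⟩
  replace hamax : ∀ n, g (w n) ≤ g (w a) := fun n => by
    rcases le_total (g (w m)) (g (w n)) with h | h
    exacts [hamax n h, h.trans ha]
  have hfin : {n : ℤ | g (w n) = g (w a)}.Finite :=
    hm.subset fun n (hn : g (w n) = g (w a)) => by
      change g (w m) ≤ g (w n)
      rw [hn]
      exact ha
  obtain ⟨k, hk, hkmin⟩ := Set.exists_min_image _ id hfin ⟨a, rfl⟩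
  replace hk : g (w k) = g (w a) := hk
  have hkeq : ∀ l : ℤ, w.shift l ∈ firstArgmaxZero G g ↔
      (∀ n, g (w n) ≤ g (w l)) ∧ ∀ n < l, g (w n) < g (w l) := by
    intro l
    refine and_congr ⟨fun h n => ?_, fun h n => ?_⟩ ⟨fun h n hn => ?_, fun h n hn => ?_⟩
    · simpa [Trajectory.shift_apply] using h (n - l)
    · simpa [Trajectory.shift_apply] using h (n + l)
    · simpa [Trajectory.shift_apply] using h (n - l) (by omega)
    · simpa [Trajectory.shift_apply] using h (n + l) (by omega)
  simp only [hkeq]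
  have hk2 : ∀ n < k, g (w n) < g (w k) := fun n hn =>
    lt_of_le_of_ne (hk ▸ hamax n) fun h => (hkmin n (h.trans hk)).not_gt hn
  refine ⟨k, ⟨fun n => hk ▸ hamax n, hk2⟩, fun l hl => ?_⟩
  rcases lt_trichotomy l k with h | h | h
  · exact absurd (hk2 l h) (hl.1 k).not_gt
  · exact h
  · exact absurd (hl.2 k h) (not_lt.2 (hk ▸ hamax l))

lemma proj_preimage_hitting (K : Finset V) :
    proj G ⁻¹' hitting G K = {w | ∃ n : ℤ, w n ∈ K} := by
  ext w
  constructor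
  · rintro ⟨v, ⟨n, hn⟩, hvw⟩
    obtain ⟨k, hk⟩ := Quotient.exact hvw
    exact ⟨n + k, hk n ▸ hn⟩
  · exact fun h => ⟨w, h, rfl⟩

lemma iUnion_hitting_singleton : ⋃ x, hitting G {x} = Set.univ := by
  refine Set.eq_univ_of_forall fun c => ?_
  obtain ⟨w, rfl⟩ := Quotient.exists_rep c
  exact Set.mem_iUnion.2 ⟨w 0, w, ⟨0, by simp⟩, rfl⟩

variable [MeasurableSpace V]

lemma measure_eq_tsum_inter_shift {μ : Measure (Trajectory G)} {B S : Set (Trajectory G)}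
    (hB : MeasurableSet B) (hS : MeasurableSet S)
    (h : ∀ᵐ w ∂μ, w ∈ B → ∃! k : ℤ, w.shift k ∈ S) :
    μ B = ∑' k : ℤ, μ (B ∩ Trajectory.shift k ⁻¹' S) := by
  have hm : ∀ k : ℤ, MeasurableSet (B ∩ Trajectory.shift k ⁻¹' S) := fun k =>
    hB.inter (measurable_shift k hS)
  simp_rw [← lintegral_indicator_one hB, ← lintegral_indicator_one (hm _)]
  rw [← lintegral_tsum fun k => (measurable_one.indicator (hm k)).aemeasurable]
  refine lintegral_congr_ae ?_
  filter_upwards [h] with w hw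
  by_cases hwB : w ∈ B
  · obtain ⟨k, hk, huniq⟩ := hw hwB
    rw [tsum_eq_single k, Set.indicator_of_mem hwB,
      Set.indicator_of_mem (show w ∈ B ∩ Trajectory.shift k ⁻¹' S from ⟨hwB, hk⟩)]
    intro l hl
    exact Set.indicator_of_notMem (fun hmem => hl (huniq l hmem.2)) _
  · rw [Set.indicator_of_notMem hwB]
    refine (ENNReal.tsum_eq_zero.2 fun k => Set.indicator_of_notMem ?_ _).symm
    exact fun hmem => hwB hmem.1

/-- For a shift-invariant measure, two sections of the time shift on a shift-invariant set `A`
give the same mass. -/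
lemma measure_inter_eq_of_selection {μ : Measure (Trajectory G)}
    (hμ : ∀ k : ℤ, MeasurePreserving (Trajectory.shift (G := G) k) μ μ)
    {A S T : Set (Trajectory G)} (hA : MeasurableSet A)
    (hAinv : ∀ (k : ℤ) (w : Trajectory G), w.shift k ∈ A ↔ w ∈ A)
    (hS : MeasurableSet S) (hT : MeasurableSet T)
    (hS' : ∀ᵐ w ∂μ, w ∈ A → ∃! k : ℤ, w.shift k ∈ S)
    (hT' : ∀ᵐ w ∂μ, w ∈ A → ∃! k : ℤ, w.shift k ∈ T) :
    μ (A ∩ S) = μ (A ∩ T) := by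
  rw [measure_eq_tsum_inter_shift (hA.inter hS) hT (hT'.mono fun w hw h => hw h.1),
    measure_eq_tsum_inter_shift (hA.inter hT) hS (hS'.mono fun w hw h => hw h.1),
    -- This is mass transport on `ℤ`: shifting by `k` exchanges the roles of the two sections, with
    -- offset `-k` in one sum matching offset `k` in the other.
    ← (Equiv.neg ℤ).tsum_eq]
  refine tsum_congr fun k => ?_
  rw [← (hμ k).measure_preimage
    ((hA.inter hS).inter (measurable_shift _ hT)).nullMeasurableSet]
  congr 1
  ext w
  simp only [Set.mem_preimage, Set.mem_inter_iff, hAinv, Equiv.neg_apply,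
    Trajectory.shift_neg_shift]
  tauto

variable [DiscreteMeasurableSpace V]

lemma measurableSet_firstArgmaxZero [Countable V] {α : Type*} [LinearOrder α] (g : V → α) :
    MeasurableSet (firstArgmaxZero G g) := by
  have hm : ∀ n : ℤ, Measurable fun w : Trajectory G => (w n, w 0) := fun n =>
    (measurable_trajectory_apply n).prodMk (measurable_trajectory_apply 0)
  have e : firstArgmaxZero G g =
      (⋂ n : ℤ, (fun w : Trajectory G => (w n, w 0)) ⁻¹' {q | g q.1 ≤ g q.2}) ∩
        ⋂ n : ℤ, ⋂ _ : n < 0, (fun w : Trajectory G => (w n, w 0)) ⁻¹' {q | g q.1 < g q.2} := by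
    ext w
    simp [firstArgmaxZero]
  rw [e]
  exact (MeasurableSet.iInter fun n => hm n MeasurableSet.of_discrete).inter
    (MeasurableSet.iInter fun n => MeasurableSet.iInter fun _ => hm n MeasurableSet.of_discrete)

lemma measurableSet_setOf_eval_mem (n : ℤ) (K : Set V) :
    MeasurableSet {w : Trajectory G | w n ∈ K} :=
  measurable_trajectory_apply n (MeasurableSet.of_discrete (s := K))

lemma measurableSet_firstEntranceZero (K : Finset V) :
    MeasurableSet (firstEntranceZero G K) := by
  have e : firstEntranceZero G K = {w : Trajectory G | w 0 ∈ (K : Set V)} ∩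
      ⋂ n : ℤ, ⋂ _ : n < 0, {w : Trajectory G | w n ∈ (K : Set V)}ᶜ := by
    ext w
    simp only [firstEntranceZero, IsLeast, lowerBounds, Set.mem_ofPred_eq, Set.mem_inter_iff,
      Set.mem_iInter, Set.mem_compl_iff, Finset.mem_coe]
    exact and_congr_right fun _ => ⟨fun h n hn hK => (h hK).not_gt hn,
      fun h n hK => not_lt.1 fun hn => h n hn hK⟩
  rw [e]
  exact (measurableSet_setOf_eval_mem 0 _).inter (MeasurableSet.iInter fun n =>
    MeasurableSet.iInter fun _ => (measurableSet_setOf_eval_mem n _).compl)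

lemma measurableSet_setOf_visits (K : Finset V) :
    MeasurableSet {w : Trajectory G | ∃ n : ℤ, w n ∈ K} := by
  have e : {w : Trajectory G | ∃ n : ℤ, w n ∈ K} =
      ⋃ n : ℤ, {w : Trajectory G | w n ∈ (K : Set V)} := by
    ext w
    simp
  rw [e]
  exact MeasurableSet.iUnion fun n => measurableSet_setOf_eval_mem n _

lemma measurableSet_hitting (K : Finset V) :
    MeasurableSet (hitting G K) := by
  change MeasurableSet (proj G ⁻¹' hitting G K)
  rw [proj_preimage_hitting]
  exact measurableSet_setOf_visits K

variable [G.LocallyFinite]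

/-- On `H_K = 0` the walk starts in `K`. The formula characterizing `ν` thus becomes a statement
about the section `{H_K = 0}` of the total law. -/
lemma totalLaw_inter_firstEntranceZero [Countable V] (K : Finset V) (B : Set (Trajectory G)) :
    totalLaw G (B ∩ firstEntranceZero G K) = entranceMass G K B := by
  rw [totalLaw_apply, entranceMass, tsum_eq_sum]
  intro x hx
  refine measure_mono_null (t := {w | w 0 ≠ x}) (fun w hw h => hx ?_)
    (twoSidedLaw_setOf_eval_zero_ne x)
  rw [← h]
  exact hw.2.1

lemma entranceMass_le [Countable V] (K : Finset V) (B : Set (Trajectory G)) :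
    entranceMass G K B ≤ K.card := by
  rw [entranceMass, ← nsmul_one, ← Finset.sum_const]
  refine Finset.sum_le_sum fun x _ => ?_
  rw [twoSidedLaw_apply]
  exact prob_le_one

/-- A measurable set which almost every trajectory enters under exactly one time shift. -/
structure IsSelection (G : SimpleGraph V) [G.LocallyFinite] (S : Set (Trajectory G)) : Prop where
  measurableSet : MeasurableSet S
  ae_existsUnique : ∀ᵐ w ∂totalLaw G, ∃! k : ℤ, w.shift k ∈ S

/-- Over the trajectories that hit `K`, both `S` and `{H_K = 0}` are sections. The sets `W*({x})`
have mass at most `1` and cover `W*`, which gives σ-finiteness. -/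
lemma IsSelection.isInterlacementMeasure [Countable V] [Nonempty V] (htrans : IsTransitive G)
    (hG : ∀ x, ∃ z, G.Adj x z) {S : Set (Trajectory G)} (hS : IsSelection G S) :
    IsInterlacementMeasure G (((totalLaw G).restrict S).map (proj G)) := by
  have key : ∀ A : Set (ShiftClass G), MeasurableSet A → ∀ K : Finset V,
      ((totalLaw G).restrict S).map (proj G) (A ∩ hitting G K) =
        entranceMass G K (proj G ⁻¹' A) := by
    intro A hA K
    have hB : MeasurableSet (proj G ⁻¹' (A ∩ hitting G K)) :=
      measurable_proj (hA.inter (measurableSet_hitting K))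
    rw [Measure.map_apply measurable_proj (hA.inter (measurableSet_hitting K)),
      Measure.restrict_apply hB,
      measure_inter_eq_of_selection (measurePreserving_shift htrans hG) hB
        (fun k w => by simp only [Set.mem_preimage, proj_shift]) hS.measurableSet
        (measurableSet_firstEntranceZero K) (hS.ae_existsUnique.mono fun w hw _ => hw)
        (Filter.Eventually.of_forall fun w hw =>
          existsUnique_shift_mem_firstEntranceZero K w
            (by rw [Set.preimage_inter, proj_preimage_hitting] at hw; exact hw.2)),
      ← totalLaw_inter_firstEntranceZero, Set.preimage_inter, proj_preimage_hitting,
      Set.inter_assoc]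
    congr 2
    exact Set.inter_eq_right.2 fun w hw => ⟨0, hw.1⟩
  refine ⟨?_, key⟩
  refine Measure.sigmaFinite_of_countable (S := Set.range fun x : V => hitting G {x})
    (Set.countable_range _) ?_ (by rw [Set.sUnion_range]; exact iUnion_hitting_singleton)
  rintro _ ⟨x, rfl⟩
  have := key Set.univ MeasurableSet.univ {x}
  rw [Set.univ_inter] at this
  rw [this]
  exact (entranceMass_le _ _).trans_lt (ENNReal.natCast_lt_top _)

lemma IsInterlacementMeasure.unique [Countable V] {μ ν : Measure (ShiftClass G)}
    (hμ : IsInterlacementMeasure G μ) (hν : IsInterlacementMeasure G ν) : μ = ν := by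
  refine Measure.ext_of_iUnion_eq_univ (iUnion_hitting_singleton (G := G)) fun x => ?_
  ext A hA
  rw [Measure.restrict_apply hA, Measure.restrict_apply hA, hμ.apply_inter_hitting A hA,
    hν.apply_inter_hitting A hA]

/-- Choose the first visit to the vertex of smallest index in an enumeration of `V`; `OrderDual`
turns this minimum into a maximum. No automorphism invariance is needed, since this section only
serves to show that `ν` exists and is nonzero. -/
lemma exists_isSelection [Countable V] : ∃ S, IsSelection G S := by
  obtain ⟨e, he⟩ := exists_injective_nat V
  refine ⟨firstArgmaxZero G fun x => OrderDual.toDual (e x), measurableSet_firstArgmaxZero _,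
    Filter.Eventually.of_forall fun w => existsUnique_shift_mem_firstArgmaxZero _ w ⟨0, ?_⟩⟩
  have hfin : {x : V | e x ≤ e (w 0)}.Finite := (Set.finite_Iic (e (w 0))).preimage he.injOn
  refine (hfin.biUnion fun x _ => w.2.2 x).subset fun n hn => ?_
  exact Set.mem_biUnion (x := w n) hn rfl

lemma isInterlacementMeasure_interlacementMeasure [Countable V] [Nonempty V]
    (htrans : IsTransitive G) (hG : ∀ x, ∃ z, G.Adj x z) :
    IsInterlacementMeasure G (interlacementMeasure G) := by
  obtain ⟨S, hS⟩ := exists_isSelection (G := G)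
  exact Classical.epsilon_spec ⟨_, hS.isInterlacementMeasure htrans hG⟩

lemma IsSelection.projectsToInterlacement [Countable V] [Nonempty V] (htrans : IsTransitive G)
    (hG : ∀ x, ∃ z, G.Adj x z) {S : Set (Trajectory G)} (hS : IsSelection G S) :
    ProjectsToInterlacement G ((totalLaw G).restrict S) := by
  intro A hA
  rw [(isInterlacementMeasure_interlacementMeasure htrans hG).unique
    (hS.isInterlacementMeasure htrans hG), Measure.map_apply measurable_proj hA]

/-- If `ν` vanished, a section and all its shifts would be null. They cover almost every trajectory,
but by transience each `P_x^±` has mass `1` on `W`. -/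
lemma interlacementMeasure_ne_zero [Countable V] [Nonempty V] (htrans : IsTransitive G)
    (hG : ∀ x, ∃ z, G.Adj x z) (ht : IsTransient G) : interlacementMeasure G ≠ 0 := by
  intro h0
  obtain ⟨S, hS⟩ := exists_isSelection (G := G)
  have hproj := hS.projectsToInterlacement htrans hG Set.univ MeasurableSet.univ
  rw [h0, Measure.coe_zero, Pi.zero_apply, Set.preimage_univ,
    Measure.restrict_apply_univ] at hproj
  have h1 := measure_eq_tsum_inter_shift (μ := totalLaw G) MeasurableSet.univ hS.measurableSet
    (hS.ae_existsUnique.mono fun w hw _ => hw)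
  have h2 : totalLaw G Set.univ = 0 := by
    rw [h1, ENNReal.tsum_eq_zero]
    intro k
    rw [Set.univ_inter, (measurePreserving_shift htrans hG k).measure_preimage
      hS.measurableSet.nullMeasurableSet, ← hproj]
  rw [totalLaw_apply, ENNReal.tsum_eq_zero] at h2
  obtain ⟨x⟩ := ‹Nonempty V›
  exact one_ne_zero ((twoSidedLaw_univ hG ht x).symm.trans (h2 x))

end Selection


/-! ### Invariant lifts of the interlacement measure -/

section Lift

variable {V : Type*} {G : SimpleGraph V}

/-- Multiplying `h` by a positive constant changes no comparison between its values along a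
trajectory. -/
lemma act_mem_firstArgmaxZero_iff {h : V → ℝ≥0} (hh : IsScaledByAut G h) (φ : G ≃g G)
    (w : Trajectory G) : Trajectory.act φ w ∈ firstArgmaxZero G h ↔ w ∈ firstArgmaxZero G h := by
  obtain ⟨c, hc, hφ⟩ := hh.2 φ
  change ((∀ n : ℤ, h (φ (w n)) ≤ h (φ (w 0))) ∧ ∀ n : ℤ, n < 0 → h (φ (w n)) < h (φ (w 0))) ↔ _
  simp only [hφ, mul_le_mul_iff_right₀ (pos_iff_ne_zero.2 hc),
    mul_lt_mul_iff_right₀ (pos_iff_ne_zero.2 hc)]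
  rfl

lemma infinite_setOf_visited (w : Trajectory G) : {y | ∃ n : ℤ, w n = y}.Infinite := by
  intro hfin
  refine Set.infinite_univ (α := ℤ) ((hfin.biUnion fun x _ => w.2.2 x).subset fun n _ => ?_)
  exact Set.mem_biUnion (x := w n) ⟨n, rfl⟩ rfl

variable [MeasurableSpace V] [DiscreteMeasurableSpace V]

lemma isAutInvariant_restrict_totalLaw [G.LocallyFinite] [Countable V] [Nonempty V]
    (hG : ∀ x, ∃ z, G.Adj x z) {S : Set (Trajectory G)} (hS : MeasurableSet S)
    (hinv : ∀ (φ : G ≃g G) (w : Trajectory G), Trajectory.act φ w ∈ S ↔ w ∈ S) :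
    IsAutInvariant G ((totalLaw G).restrict S) := by
  intro φ B hB
  have hφ := measurePreserving_act hG φ.symm
  rw [Trajectory.act_image, Measure.restrict_apply hB, Measure.restrict_apply (hφ.measurable hB),
    ← hφ.measure_preimage (hB.inter hS).nullMeasurableSet]
  congr 1
  ext w
  simp only [Set.mem_preimage, Set.mem_inter_iff, hinv]

/-- The level `h (w 0)` is positive, so it is reached only finitely often in each time direction. -/
lemma isSelection_firstArgmaxZero [G.LocallyFinite] [Countable V] {h : V → ℝ≥0} {c : ℝ≥0∞}
    (hc : c < 1) (h0 : ∀ x, h x ≠ 0) (hh : ∀ y, ∫⁻ z, h z ∂srwKernel G y = c * h y) :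
    IsSelection G (firstArgmaxZero G h) := by
  refine ⟨measurableSet_firstArgmaxZero h, ?_⟩
  filter_upwards [ae_totalLaw fun x => ae_srwLaw_finite_setOf_le G x hc hh] with w hw
  refine existsUnique_shift_mem_firstArgmaxZero h w ⟨0, ?_⟩
  refine (((hw.1 _ (h0 (w 0))).image fun n : ℕ => (n : ℤ)).union
    ((hw.2 _ (h0 (w 0))).image fun n : ℕ => (-n : ℤ))).subset fun n hn => ?_
  obtain ⟨m, rfl | rfl⟩ := n.eq_nat_or_neg
  · exact Or.inl ⟨m, hn, rfl⟩
  · exact Or.inr ⟨m, hn, rfl⟩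

lemma exists_invariant_lift_of_not_isUnimodular [G.LocallyFinite] [Countable V] [Nonempty V]
    (hconn : G.Connected) (htrans : IsTransitive G) (hG : ∀ x, ∃ z, G.Adj x z)
    (hnot : ¬ IsUnimodular G) :
    ∃ Q : Measure (Trajectory G), ProjectsToInterlacement G Q ∧ IsAutInvariant G Q := by
  obtain ⟨h, c, hc, hscaled, hsum⟩ := exists_scaled_superharmonic hconn htrans hnot
  have hint : ∀ y, ∫⁻ z, h z ∂srwKernel G y = (c : ℝ≥0∞) * h y := by
    intro y
    have hdeg : (G.degree y : ℝ≥0∞) ≠ 0 := by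
      have := (G.degree_pos_iff_exists_adj y).2 (hG y)
      exact_mod_cast this.ne'
    rw [lintegral_srwKernel G (hG y), ← ENNReal.ofNNReal_finsetSum, hsum, ENNReal.coe_mul,
      ENNReal.coe_mul, ENNReal.coe_natCast, mul_right_comm,
      ENNReal.mul_div_cancel_right hdeg (ENNReal.natCast_ne_top _)]
  have hS := isSelection_firstArgmaxZero (by exact_mod_cast hc) hscaled.1 hint
  exact ⟨_, hS.projectsToInterlacement htrans hG,
    isAutInvariant_restrict_totalLaw hG hS.measurableSet (act_mem_firstArgmaxZero_iff hscaled)⟩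

lemma measurableSet_setOf_start_visits (x y : V) :
    MeasurableSet {w : Trajectory G | w 0 = x ∧ ∃ n : ℤ, w n = y} := by
  have e : {w : Trajectory G | w 0 = x ∧ ∃ n : ℤ, w n = y} =
      {w : Trajectory G | w 0 ∈ ({x} : Set V)} ∩ {w | ∃ n : ℤ, w n ∈ ({y} : Finset V)} := by
    ext w
    simp
  rw [e]
  exact (measurableSet_setOf_eval_mem 0 _).inter (measurableSet_setOf_visits _)

/-- Under every measure, the expected number of vertices visited by trajectories started at `x`
is infinite, unless almost no trajectory starts at `x`. -/
lemma tsum_start_visits_eq_top [Countable V] {Q : Measure (Trajectory G)} {x : V}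
    (hx : Q {w | w 0 = x} ≠ 0) :
    ∑' y, Q {w | w 0 = x ∧ ∃ n : ℤ, w n = y} = ∞ := by
  have hm := fun y => measurableSet_setOf_start_visits (G := G) x y
  simp_rw [← lintegral_indicator_one (hm _)]
  rw [← lintegral_tsum fun y => (measurable_one.indicator (hm y)).aemeasurable]
  have hx' : MeasurableSet {w : Trajectory G | w 0 = x} :=
    measurableSet_setOf_eval_mem 0 {x}
  have e : ∀ w : Trajectory G, ∑' y, {w : Trajectory G | w 0 = x ∧ ∃ n : ℤ, w n = y}.indicator
      (1 : Trajectory G → ℝ≥0∞) w = {w : Trajectory G | w 0 = x}.indicator (fun _ => ∞) w := by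
    intro w
    by_cases hw : w 0 = x
    · rw [Set.indicator_of_mem (show w ∈ {w : Trajectory G | w 0 = x} from hw)]
      have : ∀ y, {w : Trajectory G | w 0 = x ∧ ∃ n : ℤ, w n = y}.indicator
          (1 : Trajectory G → ℝ≥0∞) w = {y | ∃ n : ℤ, w n = y}.indicator (fun _ => 1) y :=
        fun y => Set.indicator_const_eq_indicator_const (by simp [hw])
      simp_rw [this]
      rw [← tsum_subtype, ENNReal.tsum_set_const, (infinite_setOf_visited w).encard_eq]
      simp
    · rw [Set.indicator_of_notMem (show w ∉ {w : Trajectory G | w 0 = x} from hw)]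
      exact ENNReal.tsum_eq_zero.2 fun y => Set.indicator_of_notMem (fun h => hw h.1) _
  rw [lintegral_congr e, lintegral_indicator_const hx', ENNReal.top_mul hx]

lemma tsum_visits [Countable V] (Q : Measure (Trajectory G)) (y : V) :
    ∑' x, Q {w | w 0 = x ∧ ∃ n : ℤ, w n = y} = Q {w | ∃ n : ℤ, w n = y} := by
  rw [← measure_iUnion]
  · congr 1
    ext w
    simp
  · intro x x' hxx'
    exact Set.disjoint_left.2 fun w hw hw' => hxx' (hw.1.symm.trans hw'.1)
  · exact fun x => measurableSet_setOf_start_visits x y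

/-- Visiting `y` is a shift-invariant event, so its `Q`-mass is `ν(W*({y}))`, which is at most one
summand of size `1`. -/
lemma ProjectsToInterlacement.apply_visits_le [G.LocallyFinite] [Countable V] [Nonempty V]
    (htrans : IsTransitive G) (hG : ∀ x, ∃ z, G.Adj x z) {Q : Measure (Trajectory G)}
    (hQ : ProjectsToInterlacement G Q) (y : V) : Q {w | ∃ n : ℤ, w n = y} ≤ 1 := by
  have h1 := hQ (hitting G {y}) (measurableSet_hitting _)
  have h2 := (isInterlacementMeasure_interlacementMeasure htrans hG).apply_inter_hitting
    Set.univ MeasurableSet.univ {y}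
  have h3 := entranceMass_le {y} (proj G ⁻¹' Set.univ)
  rw [← h2, Set.univ_inter, h1, proj_preimage_hitting, Finset.card_singleton, Nat.cast_one] at h3
  simpa using h3

lemma not_isUnimodular_of_invariant_lift [G.LocallyFinite] [Countable V] [Nonempty V]
    (htrans : IsTransitive G) (hG : ∀ x, ∃ z, G.Adj x z) (ht : IsTransient G)
    {Q : Measure (Trajectory G)} (hQ : ProjectsToInterlacement G Q) (hinv : IsAutInvariant G Q) :
    ¬ IsUnimodular G := by
  intro huni
  have hle := hQ.apply_visits_le htrans hG
  obtain ⟨o, ho⟩ : ∃ o, Q {w | w 0 = o} ≠ 0 := by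
    by_contra! hzero
    have huniv : Q Set.univ = 0 := by
      rw [show (Set.univ : Set (Trajectory G)) = ⋃ o, {w | w 0 = o} by ext w; simp]
      exact measure_iUnion_null hzero
    refine interlacementMeasure_ne_zero htrans hG ht (Measure.measure_univ_eq_zero.1 ?_)
    rw [hQ Set.univ MeasurableSet.univ, Set.preimage_univ, huniv]
  have hfin : ∀ x y, Q {w | w 0 = x ∧ ∃ n : ℤ, w n = y} ≠ ∞ := fun x y =>
    ne_top_of_le_ne_top ENNReal.one_ne_top ((measure_mono fun w hw => hw.2).trans (hle y))
  -- Passing to `ℝ≥0` loses nothing by `hfin`. The left sum, the mass sent out by `o`, is infinite;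
  -- the right sum, the mass received, is at most `1`.
  have hmt := huni (fun x y => (Q {w | w 0 = x ∧ ∃ n : ℤ, w n = y}).toNNReal) ?_ o
  · simp only [ENNReal.coe_toNNReal (hfin _ _)] at hmt
    rw [tsum_start_visits_eq_top ho, tsum_visits] at hmt
    exact absurd (hle o) (by rw [← hmt]; simp)
  · intro φ x y
    dsimp only
    rw [hinv φ _ (measurableSet_setOf_start_visits x y), Trajectory.act_image]
    congr 2
    ext w
    refine and_congr ?_ (exists_congr fun n => ?_)
    · exact (φ.toEquiv.symm_apply_eq).symm
    · exact (φ.toEquiv.symm_apply_eq).symm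

end Lift

end RI

end

theorem proposition1p3 {V : Type*} [MeasurableSpace V] [DiscreteMeasurableSpace V]
    (G : SimpleGraph V) [G.LocallyFinite] (hconn : G.Connected)
    (htransitive : RI.IsTransitive G) (htransient : RI.IsTransient G) :
    RI.IsUnimodular G ↔
      ¬ ∃ Q : MeasureTheory.Measure (RI.Trajectory G),
        RI.ProjectsToInterlacement G Q ∧ RI.IsAutInvariant G Q := by
  have := RI.countable_of_connected hconn
  have := hconn.nonempty
  have hG := RI.exists_adj_of_isTransient G hconn htransient
  refine ⟨?_, fun h => ?_⟩
  · rintro huni ⟨Q, hQ, hinv⟩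
    exact RI.not_isUnimodular_of_invariant_lift htransitive hG htransient hQ hinv huni
  · by_contra hnot
    exact h (RI.exists_invariant_lift_of_not_isUnimodular hconn htransitive hG hnot)
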